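/- Work in the two-sorted language of second-order arithmetic, with symbols $0,1,+,\cdot,<,\in$. A structure for it is a pair $(M,S)$ with $M$ a structure for $0,1,+,\cdot,<$ and $S$ a nonempty collection of subsets of $M$ over which the set variables range. $\mathsf{RCA}_0$ is the theory consisting of the axioms of a discretely ordered commutative semiring with identity (and least element $0$), the $\Sigma^0_1$ induction scheme, and the $\Delta^0_1$ comprehension scheme, where the schemes apply to formulas with number and set parameters. Write $\mathbb N$ for the first-order part, code a pair $(x,y)$ by the number $(x+y)^2+x$, and call a set $X\subseteq\mathbb N$ infinite if $\forall n\,\exists m\,(m\in X\wedge n<m)$. Let $[X]^2=\{(x,y): x,y\in X,\ x<y\}$. A graph $G=(V,E)$ is given by sets $V\subseteq\mathbb N$ and $E\subseteq[V]^2$; it is infinite if $V$ is, and $N(x)$ denotes the set of $y\in V$ with $(\min\{x,y\},\max\{x,y\})\in E$. Consider the following statements. 1. $\mathsf{RT}^2_2$: for every $c\colon[\mathbb N]^2\to\{0,1\}$ there are an infinite set $H\subseteq\mathbb N$ and an $i\in\{0,1\}$ such that $c(x,y)=i$ for all $(x,y)\in[H]^2$. 2. $\mathsf{wRSg}$ (the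 weak Rival--Sands theorem): for every infinite graph $G=(V,E)$ there is an infinite set $H\subseteq V$ such that for every $x\in H$, either $H\cap N(x)$ is infinite or $|H\cap N(x)|\le 1$. 3. $\mathsf{wRSgr}$ (the refined weak Rival--Sands theorem): for every infinite graph $G=(V,E)$ there is an infinite set $H\subseteq V$ such that for every $x\in H$, either $H\cap N(x)$ is infinite or $H\cap N(x)=\emptyset$. Theorem. The statements 1, 2 and 3 are equivalent over $\mathsf{RCA}_0$; that is, in every model $(M,S)$ of $\mathsf{RCA}_0$, if one of them holds, then all three hold. -/

import Mathlib

/-!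
Second-order arithmetic in the two-sorted language `0, 1, +, ·, <, ∈`.

A structure for this language consists of a first-order part `M`, carrying `0, 1, +, ·, <`, and
of a nonempty collection `S` of subsets of `M` over which the set quantifiers range.
-/

namespace SecondOrderArithmetic

universe u

/-- Terms of the first sort; number variables are de Bruijn indices. -/
inductive Term : Type
  | var : ℕ → Term
  | zero : Term
  | one : Term
  | add : Term → Term → Term
  | mul : Term → Term → Term

/-- Bounded-quantifier (`Δ⁰₀`) formulas.  `mem t j` says that `t` belongs to the `j`-th set
variable.  In `ball t φ` (for all `x < t`, `φ`) and `bex t φ` (for some `x < t`, `φ`) the bound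
variable `x` is number variable `0` of `φ`, it does not occur in `t`, and number variable `i` of
the context is number variable `i + 1` of `φ`. -/
inductive BoundedFormula : Type
  | eq : Term → Term → BoundedFormula
  | lt : Term → Term → BoundedFormula
  | mem : Term → ℕ → BoundedFormula
  | neg : BoundedFormula → BoundedFormula
  | and : BoundedFormula → BoundedFormula → BoundedFormula
  | or : BoundedFormula → BoundedFormula → BoundedFormula
  | ball : Term → BoundedFormula → BoundedFormula
  | bex : Term → BoundedFormula → BoundedFormula

/-- The assignment `a, v 0, v 1, v 2, …`. -/
def push {M : Type u} (a : M) (v : ℕ → M) : ℕ → M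
  | 0 => a
  | i + 1 => v i

/-- The value of a term under an assignment `v` of the number variables. -/
def Term.eval {M : Type u} [Zero M] [One M] [Add M] [Mul M] (v : ℕ → M) : Term → M
  | .var i => v i
  | .zero => 0
  | .one => 1
  | .add s t => s.eval v + t.eval v
  | .mul s t => s.eval v * t.eval v

/-- Truth of a bounded-quantifier formula under an assignment `v` of the number variables and an
assignment `W` of the set variables. -/
def BoundedFormula.Holds {M : Type u} [Zero M] [One M] [Add M] [Mul M] [LT M] (W : ℕ → Set M) :
    BoundedFormula → (ℕ → M) → Prop
  | .eq s t, v => s.eval v = t.eval v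
  | .lt s t, v => s.eval v < t.eval v
  | .mem t j, v => t.eval v ∈ W j
  | .neg φ, v => ¬ φ.Holds W v
  | .and φ ψ, v => φ.Holds W v ∧ ψ.Holds W v
  | .or φ ψ, v => φ.Holds W v ∨ ψ.Holds W v
  | .ball t φ, v => ∀ x : M, x < t.eval v → φ.Holds W (push x v)
  | .bex t φ, v => ∃ x : M, x < t.eval v ∧ φ.Holds W (push x v)

/-- Truth of the `Σ⁰₁` formula `∃ m, θ`, with `m` the number variable `0` of `θ`. -/
def SigmaHolds {M : Type u} [Zero M] [One M] [Add M] [Mul M] [LT M] (W : ℕ → Set M)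
    (θ : BoundedFormula) (v : ℕ → M) : Prop :=
  ∃ m : M, θ.Holds W (push m v)

/-- Truth of the `Π⁰₁` formula `∀ m, θ`, with `m` the number variable `0` of `θ`. -/
def PiHolds {M : Type u} [Zero M] [One M] [Add M] [Mul M] [LT M] (W : ℕ → Set M)
    (θ : BoundedFormula) (v : ℕ → M) : Prop :=
  ∀ m : M, θ.Holds W (push m v)

/-- `(M, S)` is a model of `RCA₀`.  Together with the type classes, `zero_le` and `discrete` say
that `M` is a discretely ordered commutative semiring with identity.  The two schemes hold for all
values in `(M, S)` of the free variables, that is, their universal closures hold; the distinguished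
variable `n` of a scheme is the number variable `0` of the formula it is applied to. -/
structure IsModelRCA0 {M : Type u} [CommSemiring M] [LinearOrder M] [IsStrictOrderedRing M]
    (S : Set (Set M)) : Prop where
  sets_nonempty : S.Nonempty
  zero_le : ∀ x : M, 0 ≤ x
  discrete : ∀ x y : M, x < y ↔ x + 1 ≤ y
  sigma_induction : ∀ (φ : BoundedFormula) (v : ℕ → M) (W : ℕ → Set M), (∀ j, W j ∈ S) →
    SigmaHolds W φ (push 0 v) →
    (∀ n : M, SigmaHolds W φ (push n v) → SigmaHolds W φ (push (n + 1) v)) →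
    ∀ n : M, SigmaHolds W φ (push n v)
  delta_comprehension : ∀ (φ ψ : BoundedFormula) (v : ℕ → M) (W : ℕ → Set M), (∀ j, W j ∈ S) →
    (∀ n : M, SigmaHolds W φ (push n v) ↔ PiHolds W ψ (push n v)) →
    ∃ X ∈ S, ∀ n : M, n ∈ X ↔ SigmaHolds W φ (push n v)

section Principles

variable {M : Type u} [CommSemiring M] [LinearOrder M]

/-- The usual code `(x + y)² + x` of the ordered pair `(x, y)` as a single number. -/
def pair (x y : M) : M := (x + y) * (x + y) + x

/-- A set of numbers is infinite, in the sense of arithmetic, if it is unbounded. -/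
def Unbounded (X : Set M) : Prop := ∀ n : M, ∃ m ∈ X, n < m

/-- `c` is (the set of codes of the pairs in the graph of) a function `[ℕ]² → {0, 1}`, where `[ℕ]²`
is the set of the pairs `(x, y)` with `x < y`. -/
def IsColoring (c : Set M) : Prop :=
  (∀ z ∈ c, ∃ x y i : M, x < y ∧ (i = 0 ∨ i = 1) ∧ z = pair (pair x y) i) ∧
  ∀ x y : M, x < y → ∃! i : M, pair (pair x y) i ∈ c

/-- `RT²₂`: every coloring of pairs with two colors has an infinite homogeneous set. -/
def RT22 (S : Set (Set M)) : Prop :=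
  ∀ c ∈ S, IsColoring c →
    ∃ H ∈ S, Unbounded H ∧ ∃ i : M, (i = 0 ∨ i = 1) ∧
      ∀ x ∈ H, ∀ y ∈ H, x < y → pair (pair x y) i ∈ c

/-- `(V, E)` is a simple graph: `E ⊆ [V]²`. -/
def IsGraph (V E : Set M) : Prop :=
  ∀ z ∈ E, ∃ x ∈ V, ∃ y ∈ V, x < y ∧ z = pair x y

/-- The set `N(x)` of neighbors of `x` in the graph `(V, E)`. -/
def neighbors (V E : Set M) (x : M) : Set M :=
  {y ∈ V | (x < y ∧ pair x y ∈ E) ∨ (y < x ∧ pair y x ∈ E)}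

/-- The weak Rival–Sands theorem `wRSg`: every infinite graph `(V, E)` has an infinite set `H` of
vertices such that for all `x ∈ H`, either `H ∩ N(x)` is infinite or `|H ∩ N(x)| ≤ 1`. -/
def WRSg (S : Set (Set M)) : Prop :=
  ∀ V ∈ S, ∀ E ∈ S, IsGraph V E → Unbounded V →
    ∃ H ∈ S, H ⊆ V ∧ Unbounded H ∧
      ∀ x ∈ H, Unbounded (H ∩ neighbors V E x) ∨ (H ∩ neighbors V E x).Subsingleton

/-- The refined weak Rival–Sands theorem `wRSgr`: every infinite graph `(V, E)` has an infinite set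
`H` of vertices such that for all `x ∈ H`, either `H ∩ N(x)` is infinite or `H ∩ N(x) = ∅`. -/
def WRSgr (S : Set (Set M)) : Prop :=
  ∀ V ∈ S, ∀ E ∈ S, IsGraph V E → Unbounded V →
    ∃ H ∈ S, H ⊆ V ∧ Unbounded H ∧
      ∀ x ∈ H, Unbounded (H ∩ neighbors V E x) ∨ H ∩ neighbors V E x = ∅

end Principles

end SecondOrderArithmetic

/-! Ramsey's theorem yields 3 because a set homogeneous for the edge relation is a clique or an
independent set, and in an infinite clique every vertex has infinitely many neighbors. Statement 3
is formally stronger than 2. The content is that 2 implies Ramsey's theorem: the coloring is first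
made stable on an infinite set, and then the stable case is solved.

For stability, the colors of the pairs `(p, x)` with `p < x` are stored as the binary digits of a
rational `q_x = V x / x`. If `q_x` converges along `X`, every digit, hence every color, is
eventually constant. All indices are powers of two, so the digit at `p` is the parity of the
integral part of `2p * q_x`, and no exponentiation or coding of finite sequences is needed.

To find `X`, statement 2 is applied to the graph joining `x < y` when `q_x ≤ q_y`. In the resulting
`H` a vertex with two neighbors has infinitely many. Hence the set `A` of such vertices is `Σ⁰₁`,
though its members are exceeded infinitely often; each vertex outside `A` has at most one neighbor,
so it eventually exceeds all later ones. This drop in complexity lets `Σ⁰₁` induction and `Δ⁰₁`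
comprehension produce a convergent subsequence (`exists_converges`).

The stable case uses the same dichotomy (`WRSg.exists_homogeneous_of_stable`): the vertices with two
neighbors either contain an infinite set in `S`, all with limit color `R`, or are bounded, leaving a
graph with at most one neighbor per vertex. -/

namespace SecondOrderArithmetic

universe u

section

variable {M : Type u}

/-! ### Renaming of variables -/

/-- Renaming of the number variables of a term. -/
def Term.rename (ρ : ℕ → ℕ) : Term → Term
  | .var i => .var (ρ i)
  | .zero => .zero
  | .one => .one
  | .add s t => .add (s.rename ρ) (t.rename ρ)
  | .mul s t => .mul (s.rename ρ) (t.rename ρ)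

/-- The renaming `ρ` under a quantifier. -/
def liftRenaming (ρ : ℕ → ℕ) : ℕ → ℕ
  | 0 => 0
  | i + 1 => ρ i + 1

/-- Renaming of the number variables by `ρ` and of the set variables by `τ`. -/
def BoundedFormula.rename (τ : ℕ → ℕ) : (ℕ → ℕ) → BoundedFormula → BoundedFormula
  | ρ, .eq s t => .eq (s.rename ρ) (t.rename ρ)
  | ρ, .lt s t => .lt (s.rename ρ) (t.rename ρ)
  | ρ, .mem t j => .mem (t.rename ρ) (τ j)
  | ρ, .neg φ => .neg (φ.rename τ ρ)
  | ρ, .and φ ψ => .and (φ.rename τ ρ) (ψ.rename τ ρ)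
  | ρ, .or φ ψ => .or (φ.rename τ ρ) (ψ.rename τ ρ)
  | ρ, .ball t φ => .ball (t.rename ρ) (φ.rename τ (liftRenaming ρ))
  | ρ, .bex t φ => .bex (t.rename ρ) (φ.rename τ (liftRenaming ρ))

theorem push_comp_liftRenaming (a : M) (v : ℕ → M) (ρ : ℕ → ℕ) :
    push a v ∘ liftRenaming ρ = push a (v ∘ ρ) := by
  funext i
  cases i <;> rfl

/-- The assignment `v 0, w 0, v 1, w 1, …`. -/
def mix {α : Type*} (v w : ℕ → α) (i : ℕ) : α := if i % 2 = 0 then v (i / 2) else w (i / 2)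

@[simp] theorem mix_even {α : Type*} (v w : ℕ → α) (i : ℕ) : mix v w (2 * i) = v i := by
  simp [mix]

@[simp] theorem mix_odd {α : Type*} (v w : ℕ → α) (i : ℕ) : mix v w (2 * i + 1) = w i := by
  have h1 : (2 * i + 1) % 2 = 1 := by omega
  have h2 : (2 * i + 1) / 2 = i := by omega
  simp [mix, h1, h2]

theorem eq_of_even_odd {α : Type*} {f g : ℕ → α} (h0 : ∀ i, f (2 * i) = g (2 * i))
    (h1 : ∀ i, f (2 * i + 1) = g (2 * i + 1)) : f = g := by
  funext i
  obtain ⟨j, rfl | rfl⟩ := Nat.even_or_odd' i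
  · exact h0 j
  · exact h1 j

section Semantics

variable [Zero M] [One M] [Add M] [Mul M]

theorem Term.eval_rename (ρ : ℕ → ℕ) (v : ℕ → M) (t : Term) :
    (t.rename ρ).eval v = t.eval (v ∘ ρ) := by
  induction t with
  | var i => rfl
  | zero => rfl
  | one => rfl
  | add s t hs ht => simp only [Term.rename, Term.eval, hs, ht]
  | mul s t hs ht => simp only [Term.rename, Term.eval, hs, ht]

theorem BoundedFormula.holds_rename [LT M] (τ : ℕ → ℕ) (W : ℕ → Set M) (φ : BoundedFormula)
    (ρ : ℕ → ℕ) (v : ℕ → M) :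
    (φ.rename τ ρ).Holds W v ↔ φ.Holds (W ∘ τ) (v ∘ ρ) := by
  induction φ generalizing ρ v with
  | eq s t => simp only [rename, Holds, Term.eval_rename]
  | lt s t => simp only [rename, Holds, Term.eval_rename]
  | mem t j => simp only [rename, Holds, Term.eval_rename, Function.comp]
  | neg φ h => simp only [rename, Holds, h]
  | and φ ψ h h' => simp only [rename, Holds, h, h']
  | or φ ψ h h' => simp only [rename, Holds, h, h']
  | ball t φ h => simp only [rename, Holds, h, Term.eval_rename, push_comp_liftRenaming]
  | bex t φ h => simp only [rename, Holds, h, Term.eval_rename, push_comp_liftRenaming]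

end Semantics

/-! ### Definability with parameters by bounded formulas -/

/-- The function `f` of assignments is given by a term with parameters. -/
class IsPoly [Zero M] [One M] [Add M] [Mul M] (f : (ℕ → M) → M) : Prop where
  exists_term : ∃ (t : Term) (p : ℕ → M), ∀ v, t.eval (mix v p) = f v

/-- The predicate `P` on assignments is given by a bounded formula with parameters. -/
class IsBounded [Zero M] [One M] [Add M] [Mul M] [LT M] (S : Set (Set M)) (P : (ℕ → M) → Prop) :
    Prop where
  exists_formula : ∃ (φ : BoundedFormula) (W : ℕ → Set M) (p : ℕ → M), (∀ j, W j ∈ S) ∧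
    ∀ v, φ.Holds W (mix v p) ↔ P v

/-- The renaming that makes room for a second list of parameters. -/
def leftParams (i : ℕ) : ℕ := if i % 2 = 0 then i else 4 * (i / 2) + 1

/-- The renaming that makes room for a first list of parameters. -/
def rightParams (i : ℕ) : ℕ := if i % 2 = 0 then i else 4 * (i / 2) + 3

theorem mix_comp_leftParams {α : Type*} (v p q : ℕ → α) :
    mix v (mix p q) ∘ leftParams = mix v p := by
  refine eq_of_even_odd (fun i => ?_) (fun i => ?_)
  · simp [leftParams]
  · have h : leftParams (2 * i + 1) = 2 * (2 * i) + 1 := by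
      simp only [leftParams]; split <;> omega
    simp only [Function.comp, h, mix_odd, mix_even]

theorem mix_comp_rightParams {α : Type*} (v p q : ℕ → α) :
    mix v (mix p q) ∘ rightParams = mix v q := by
  refine eq_of_even_odd (fun i => ?_) (fun i => ?_)
  · simp [rightParams]
  · have h : rightParams (2 * i + 1) = 2 * (2 * i + 1) + 1 := by
      simp only [rightParams]; split <;> omega
    simp only [Function.comp, h, mix_odd]

section Terms

variable [Zero M] [One M] [Add M] [Mul M]

theorem IsPoly.common {f g : (ℕ → M) → M} (hf : IsPoly f) (hg : IsPoly g) :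
    ∃ (s t : Term) (p : ℕ → M), ∀ v, s.eval (mix v p) = f v ∧ t.eval (mix v p) = g v := by
  obtain ⟨s, p, hs⟩ := hf
  obtain ⟨t, q, ht⟩ := hg
  refine ⟨s.rename leftParams, t.rename rightParams, mix p q, fun v => ?_⟩
  rw [Term.eval_rename, Term.eval_rename, mix_comp_leftParams, mix_comp_rightParams]
  exact ⟨hs v, ht v⟩

instance IsPoly.var (i : ℕ) : IsPoly (fun v : ℕ → M => v i) :=
  ⟨.var (2 * i), fun _ => 0, fun v => by simp [Term.eval]⟩

instance IsPoly.const (a : M) : IsPoly (fun _ : ℕ → M => a) :=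
  ⟨.var 1, fun _ => a, fun v => by simpa [Term.eval] using mix_odd v (fun _ => a) 0⟩

instance IsPoly.add (f g : (ℕ → M) → M) [hf : IsPoly f] [hg : IsPoly g] :
    IsPoly (fun v => f v + g v) := by
  obtain ⟨s, t, p, h⟩ := hf.common hg
  exact ⟨.add s t, p, fun v => by simp only [Term.eval, h v]⟩

instance IsPoly.mul (f g : (ℕ → M) → M) [hf : IsPoly f] [hg : IsPoly g] :
    IsPoly (fun v => f v * g v) := by
  obtain ⟨s, t, p, h⟩ := hf.common hg
  exact ⟨.mul s t, p, fun v => by simp only [Term.eval, h v]⟩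

theorem IsBounded.common [LT M] {S : Set (Set M)} {P Q : (ℕ → M) → Prop} (hP : IsBounded S P)
    (hQ : IsBounded S Q) :
    ∃ (φ ψ : BoundedFormula) (W : ℕ → Set M) (p : ℕ → M), (∀ j, W j ∈ S) ∧
      ∀ v, (φ.Holds W (mix v p) ↔ P v) ∧ (ψ.Holds W (mix v p) ↔ Q v) := by
  obtain ⟨φ, W, p, hW, hφ⟩ := hP
  obtain ⟨ψ, X, q, hX, hψ⟩ := hQ
  refine ⟨φ.rename (fun j => 2 * j) leftParams, ψ.rename (fun j => 2 * j + 1) rightParams,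
    mix W X, mix p q, fun j => ?_, fun v => ?_⟩
  · unfold mix
    split
    · exact hW _
    · exact hX _
  · have h0 : mix W X ∘ (fun j => 2 * j) = W := funext fun j => mix_even W X j
    have h1 : mix W X ∘ (fun j => 2 * j + 1) = X := funext fun j => mix_odd W X j
    rw [BoundedFormula.holds_rename, BoundedFormula.holds_rename, mix_comp_leftParams,
      mix_comp_rightParams, h0, h1]
    exact ⟨hφ v, hψ v⟩

theorem IsPoly.common_bounded [LT M] {S : Set (Set M)} {f : (ℕ → M) → M} {P : (ℕ → M) → Prop}
    (hf : IsPoly f) (hP : IsBounded S P) :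
    ∃ (t : Term) (φ : BoundedFormula) (W : ℕ → Set M) (p : ℕ → M), (∀ j, W j ∈ S) ∧
      ∀ v, t.eval (mix v p) = f v ∧ (φ.Holds W (mix v p) ↔ P v) := by
  obtain ⟨t, p, ht⟩ := hf
  obtain ⟨φ, W, q, hW, hφ⟩ := hP
  refine ⟨t.rename leftParams, φ.rename id rightParams, W, mix p q, hW, fun v => ?_⟩
  rw [BoundedFormula.holds_rename, Term.eval_rename, mix_comp_leftParams, mix_comp_rightParams,
    Function.comp_id]
  exact ⟨ht v, hφ v⟩

/-- The renaming that moves the bound variable in front of the parameters. -/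
def bindFirst (i : ℕ) : ℕ := if i % 2 = 0 then i - 1 else i + 1

theorem push_mix_comp_bindFirst {α : Type u} (x : α) (v p : ℕ → α) :
    push x (mix v p) ∘ bindFirst = mix (push x v) p := by
  refine eq_of_even_odd (fun i => ?_) (fun i => ?_)
  · cases i with
    | zero => simp [bindFirst, push, mix]
    | succ j =>
      have h : bindFirst (2 * (j + 1)) = 2 * j + 1 := by
        simp only [bindFirst]; split <;> omega
      simp only [Function.comp, h, mix_even, push]
  · have h : bindFirst (2 * i + 1) = 2 * i + 1 + 1 := by
      simp only [bindFirst]; split <;> omega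
    simp only [Function.comp, h, mix_odd, push]

/-- The renaming `ρ`, fixing the parameters. -/
def fixParams (ρ : ℕ → ℕ) (i : ℕ) : ℕ := if i % 2 = 0 then 2 * ρ (i / 2) else i

theorem mix_comp_fixParams {α : Type*} (v p : ℕ → α) (ρ : ℕ → ℕ) :
    mix v p ∘ fixParams ρ = mix (v ∘ ρ) p := by
  refine eq_of_even_odd (fun i => ?_) (fun i => ?_)
  · simp [fixParams]
  · have h : fixParams ρ (2 * i + 1) = 2 * i + 1 := by simp only [fixParams]; split <;> omega
    simp only [Function.comp, h, mix_odd]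

theorem IsPoly.comp {f : (ℕ → M) → M} (hf : IsPoly f) (ρ : ℕ → ℕ) :
    IsPoly fun v => f (v ∘ ρ) := by
  obtain ⟨t, p, h⟩ := hf
  exact ⟨t.rename (fixParams ρ), p, fun v => by rw [Term.eval_rename, mix_comp_fixParams, h]⟩

theorem IsBounded.comp [LT M] {S : Set (Set M)} {P : (ℕ → M) → Prop} (hP : IsBounded S P)
    (ρ : ℕ → ℕ) : IsBounded S fun v => P (v ∘ ρ) := by
  obtain ⟨φ, W, p, hW, h⟩ := hP
  exact ⟨φ.rename id (fixParams ρ), W, p, hW, fun v => by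
    rw [BoundedFormula.holds_rename, Function.comp_id, mix_comp_fixParams, h]⟩

/-- The renaming for formulas in the variables `0` and `1` only. -/
def swapFirst (i : ℕ) : ℕ := if i % 2 = 1 then i / 2 + 2 else if i = 0 then 1 else 0

/-- Matches the variable order of the schemes, where the witness `m` precedes `n` and the parameters
follow, with that of `IsBounded`, where `n` is variable `0`. Variables beyond the first all receive
`m`, harmless for predicates of `v 0` and `v 1`. -/
theorem holds_swapFirst [LT M] (φ : BoundedFormula) (W : ℕ → Set M) (p : ℕ → M) (n m : M) :
    (φ.rename id swapFirst).Holds W (push m (push n p)) ↔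
      φ.Holds W (mix (push n fun _ => m) p) := by
  rw [BoundedFormula.holds_rename, Function.comp_id]
  suffices push m (push n p) ∘ swapFirst = mix (push n fun _ => m) p by rw [this]
  refine eq_of_even_odd (fun i => ?_) (fun i => ?_)
  · cases i with
    | zero => simp [swapFirst, push, mix]
    | succ j =>
      have h : swapFirst (2 * (j + 1)) = 0 := by simp [swapFirst]
      simp only [Function.comp, h, mix_even, push]
  · have h : swapFirst (2 * i + 1) = i + 1 + 1 := by
      simp only [swapFirst]; split <;> omega
    simp only [Function.comp, h, mix_odd, push]

theorem IsBounded.congr [LT M] {S : Set (Set M)} {P Q : (ℕ → M) → Prop} (hP : IsBounded S P)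
    (h : ∀ v, P v ↔ Q v) : IsBounded S Q := by
  rwa [show Q = P from funext fun v => propext (h v).symm]

end Terms

/-! ### Closure of bounded definability under connectives and bounded quantifiers -/

section Closure

variable [CommSemiring M] [LinearOrder M] [IsStrictOrderedRing M] {S : Set (Set M)}

instance IsBounded.and (P Q : (ℕ → M) → Prop) [hP : IsBounded S P] [hQ : IsBounded S Q] :
    IsBounded S (fun v => P v ∧ Q v) := by
  obtain ⟨φ, ψ, W, p, hW, h⟩ := hP.common hQ
  exact ⟨.and φ ψ, W, p, hW, fun v => by simp only [BoundedFormula.Holds, h v]⟩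

instance IsBounded.or (P Q : (ℕ → M) → Prop) [hP : IsBounded S P] [hQ : IsBounded S Q] :
    IsBounded S (fun v => P v ∨ Q v) := by
  obtain ⟨φ, ψ, W, p, hW, h⟩ := hP.common hQ
  exact ⟨.or φ ψ, W, p, hW, fun v => by simp only [BoundedFormula.Holds, h v]⟩

instance IsBounded.not (P : (ℕ → M) → Prop) [hP : IsBounded S P] :
    IsBounded S (fun v => ¬ P v) := by
  obtain ⟨φ, W, p, hW, h⟩ := hP
  exact ⟨.neg φ, W, p, hW, fun v => by simp only [BoundedFormula.Holds, h v]⟩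

instance IsBounded.imp (P Q : (ℕ → M) → Prop) [IsBounded S P] [IsBounded S Q] :
    IsBounded S (fun v => P v → Q v) :=
  IsBounded.congr (P := fun v => ¬ P v ∨ Q v) inferInstance fun _ => imp_iff_not_or.symm

instance IsBounded.iff (P Q : (ℕ → M) → Prop) [IsBounded S P] [IsBounded S Q] :
    IsBounded S (fun v => P v ↔ Q v) :=
  IsBounded.congr (P := fun v => (P v → Q v) ∧ (Q v → P v)) inferInstance
    fun _ => iff_iff_implies_and_implies.symm

instance IsBounded.mem (f : (ℕ → M) → M) [hf : IsPoly f] (X : Set M) [hX : Fact (X ∈ S)] :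
    IsBounded S (fun v => f v ∈ X) := by
  obtain ⟨t, p, h⟩ := hf
  exact ⟨.mem t 0, fun _ => X, p, fun _ => hX.out, fun v => by simp only [BoundedFormula.Holds, h v]⟩

instance IsBounded.ball (f : (ℕ → M) → M) (Q : M → (ℕ → M) → Prop) [hf : IsPoly f]
    [hQ : IsBounded S (fun v => Q (v 0) (fun i => v (i + 1)))] :
    IsBounded S (fun v => ∀ x, x < f v → Q x v) := by
  obtain ⟨t, φ, W, p, hW, h⟩ := hf.common_bounded hQ
  refine ⟨.ball t (φ.rename id bindFirst), W, p, hW, fun v => ?_⟩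
  simp only [BoundedFormula.Holds, BoundedFormula.holds_rename, push_mix_comp_bindFirst,
    Function.comp_id, (h _).2, (h _).1, push]

instance IsBounded.bex (f : (ℕ → M) → M) (Q : M → (ℕ → M) → Prop) [hf : IsPoly f]
    [hQ : IsBounded S (fun v => Q (v 0) (fun i => v (i + 1)))] :
    IsBounded S (fun v => ∃ x, x < f v ∧ Q x v) := by
  obtain ⟨t, φ, W, p, hW, h⟩ := hf.common_bounded hQ
  refine ⟨.bex t (φ.rename id bindFirst), W, p, hW, fun v => ?_⟩
  simp only [BoundedFormula.Holds, BoundedFormula.holds_rename, push_mix_comp_bindFirst,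
    Function.comp_id, (h _).2, (h _).1, push]

instance IsPoly.pair (f g : (ℕ → M) → M) [IsPoly f] [IsPoly g] :
    IsPoly (fun v => pair (f v) (g v)) :=
  inferInstanceAs (IsPoly fun v => (f v + g v) * (f v + g v) + f v)

variable [hS : Fact (IsModelRCA0 S)]

/-- No set variable occurs, but the set assignment must still take values in `S`; this is where `S`
has to be nonempty. -/
instance IsBounded.eq (f g : (ℕ → M) → M) [hf : IsPoly f] [hg : IsPoly g] :
    IsBounded S (fun v => f v = g v) := by
  obtain ⟨s, t, p, h⟩ := hf.common hg
  obtain ⟨X, hX⟩ := hS.out.sets_nonempty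
  exact ⟨.eq s t, fun _ => X, p, fun _ => hX, fun v => by simp only [BoundedFormula.Holds, h v]⟩

instance IsBounded.ne (f g : (ℕ → M) → M) [hf : IsPoly f] [hg : IsPoly g] :
    IsBounded S (fun v => f v ≠ g v) :=
  inferInstanceAs (IsBounded S fun v => ¬ f v = g v)

instance IsBounded.lt (f g : (ℕ → M) → M) [hf : IsPoly f] [hg : IsPoly g] :
    IsBounded S (fun v => f v < g v) := by
  obtain ⟨s, t, p, h⟩ := hf.common hg
  obtain ⟨X, hX⟩ := hS.out.sets_nonempty
  exact ⟨.lt s t, fun _ => X, p, fun _ => hX, fun v => by simp only [BoundedFormula.Holds, h v]⟩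

instance IsBounded.le (f g : (ℕ → M) → M) [hf : IsPoly f] [hg : IsPoly g] :
    IsBounded S (fun v => f v ≤ g v) :=
  IsBounded.congr (P := fun v => ¬ g v < f v) inferInstance fun _ => not_lt

/-- The relation `R` is given by a bounded formula with parameters. -/
class IsBoundedRel (S : Set (Set M)) (R : M → M → Prop) : Prop where
  isBounded : IsBounded S fun v => R (v 0) (v 1)

/-- Renaming substitutes only variables, so the values of `f` and `g` are named by bounded
quantifiers `x < f v + 1`, `y < g v + 1` before `R` is applied. -/
instance IsBounded.rel (R : M → M → Prop) (f g : (ℕ → M) → M)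
    [hR : IsBoundedRel S R] [IsPoly f] [IsPoly g] : IsBounded S fun v => R (f v) (g v) := by
  have hR' : IsBounded S fun v => R (v 1) (v 0) := hR.isBounded.comp (fun i => 1 - i)
  have hf : IsPoly fun v => f fun i => v (i + 1) := IsPoly.comp ‹_› fun i => i + 1
  have hg : IsPoly fun v => g fun i => v (i + 1) := IsPoly.comp ‹_› fun i => i + 1
  have hg' : IsPoly fun v => g fun i => v (i + 1 + 1) := IsPoly.comp ‹_› fun i => i + 1 + 1
  refine IsBounded.congr
    (P := fun v => ∃ x < f v + 1, x = f v ∧ ∃ y < g v + 1, y = g v ∧ R x y) inferInstance fun v => ?_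
  constructor
  · rintro ⟨x, -, rfl, y, -, rfl, h⟩
    exact h
  · exact fun h => ⟨_, lt_add_one _, rfl, _, lt_add_one _, rfl, h⟩

/-! ### The schemes of `RCA₀` -/

theorem sigma_induction (P : M → M → Prop) [hP : IsBounded S fun v => P (v 0) (v 1)]
    (h0 : ∃ m, P 0 m) (h1 : ∀ n, (∃ m, P n m) → ∃ m, P (n + 1) m) (n : M) : ∃ m, P n m := by
  obtain ⟨φ, W, p, hW, h⟩ := hP
  have key (n : M) : SigmaHolds W (φ.rename id swapFirst) (push n p) ↔ ∃ m, P n m :=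
    exists_congr fun m => by rw [holds_swapFirst, h]; rfl
  have := hS.out.sigma_induction (φ.rename id swapFirst) p W hW
  simp only [key] at this
  exact this h0 h1 n

theorem delta_comprehension (P Q : M → M → Prop) [hP : IsBounded S fun v => P (v 0) (v 1)]
    [hQ : IsBounded S fun v => Q (v 0) (v 1)] (h : ∀ n, (∃ m, P n m) ↔ ∀ m, Q n m) :
    {n | ∃ m, P n m} ∈ S := by
  obtain ⟨φ, ψ, W, p, hW, hv⟩ := hP.common hQ
  have key (n : M) : SigmaHolds W (φ.rename id swapFirst) (push n p) ↔ ∃ m, P n m :=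
    exists_congr fun m => by rw [holds_swapFirst, (hv _).1]; rfl
  have key' (n : M) : PiHolds W (ψ.rename id swapFirst) (push n p) ↔ ∀ m, Q n m :=
    forall_congr' fun m => by rw [holds_swapFirst, (hv _).2]; rfl
  obtain ⟨X, hX, hXn⟩ := hS.out.delta_comprehension (φ.rename id swapFirst) (ψ.rename id swapFirst)
    p W hW fun n => by rw [key, key', h]
  rwa [show {n | ∃ m, P n m} = X from Set.ext fun n => by rw [hXn, key]; rfl]

theorem comprehension (P : M → Prop) [hP : IsBounded S fun v => P (v 0)] : {n | P n} ∈ S := by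
  have := delta_comprehension (S := S) (fun n _ => P n) (fun n _ => P n) (by simp)
  simpa using this

theorem bounded_induction (P : M → Prop) [hP : IsBounded S fun v => P (v 0)]
    (h0 : P 0) (h1 : ∀ n, P n → P (n + 1)) (n : M) : P n := by
  simpa using sigma_induction (S := S) (fun n _ => P n) (by simpa using h0) (by simpa using h1) n

end Closure

end

section

variable {M : Type u} [CommSemiring M] [LinearOrder M] [IsStrictOrderedRing M] {S : Set (Set M)}

/-! ### Arithmetic in models of `RCA₀` -/

theorem IsModelRCA0.lt_add_one_iff (hS : IsModelRCA0 S) {x y : M} : x < y + 1 ↔ x ≤ y := by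
  rw [hS.discrete, add_le_add_iff_right]

theorem IsModelRCA0.lt_one_iff (hS : IsModelRCA0 S) {x : M} : x < 1 ↔ x = 0 := by
  rw [← zero_add (1 : M), hS.lt_add_one_iff]
  exact ⟨fun h => h.antisymm (hS.zero_le x), fun h => h.le⟩

theorem IsModelRCA0.one_le (hS : IsModelRCA0 S) {x : M} (hx : x ≠ 0) : 1 ≤ x :=
  not_lt.1 fun h => hx (hS.lt_one_iff.1 h)

theorem IsModelRCA0.le_pair_left (hS : IsModelRCA0 S) (x y : M) : x ≤ pair x y :=
  le_add_of_nonneg_left (mul_nonneg (hS.zero_le _) (hS.zero_le _))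

theorem IsModelRCA0.le_pair_right (hS : IsModelRCA0 S) (x y : M) : y ≤ pair x y := by
  rcases eq_or_ne y 0 with rfl | hy
  · exact hS.zero_le _
  · have h1 : y ≤ x + y := le_add_of_nonneg_left (hS.zero_le x)
    have h2 : 1 ≤ x + y := (hS.one_le hy).trans h1
    calc y ≤ x + y := h1
      _ ≤ (x + y) * (x + y) := le_mul_of_one_le_left (hS.zero_le _) h2
      _ ≤ pair x y := le_add_of_nonneg_right (hS.zero_le x)

/-- With `s = x + y`, the code lies between `s²` and `(s + 1)²`, so codes are ordered first by the
sum. -/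
theorem IsModelRCA0.pair_lt_pair (hS : IsModelRCA0 S) {x y x' y' : M} (h : x + y < x' + y') :
    pair x y < pair x' y' := by
  have h1 : x + y + 1 ≤ x' + y' := (hS.discrete _ _).1 h
  have h0 : (0 : M) ≤ x + y + 1 := hS.zero_le _
  calc pair x y = (x + y) * (x + y) + x := rfl
    _ < (x + y) * (x + y) + x + 1 := lt_add_one _
    _ ≤ (x + y) * (x + y) + x + 1 + (x + y + y) := le_add_of_nonneg_right (hS.zero_le _)
    _ = (x + y + 1) * (x + y + 1) := by ring
    _ ≤ (x' + y') * (x' + y') := mul_le_mul h1 h1 h0 (h0.trans h1)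
    _ ≤ pair x' y' := le_add_of_nonneg_right (hS.zero_le _)

theorem IsModelRCA0.pair_inj (hS : IsModelRCA0 S) {x y x' y' : M} (h : pair x y = pair x' y') :
    x = x' ∧ y = y' := by
  have hs : x + y = x' + y' := by
    rcases lt_trichotomy (x + y) (x' + y') with h' | h' | h'
    · exact absurd h (hS.pair_lt_pair h').ne
    · exact h'
    · exact absurd h (hS.pair_lt_pair h').ne'
  have hx : x = x' := by
    unfold pair at h
    rw [hs] at h
    exact add_left_cancel h
  subst hx
  exact ⟨rfl, add_left_cancel hs⟩

section

variable [hS : Fact (IsModelRCA0 S)]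

/-! ### Least and greatest elements, and unbounded subsets of `Σ⁰₁` sets -/

theorem exists_least (P : M → Prop) [hP : IsBounded S fun v => P (v 0)] (h : ∃ n, P n) :
    ∃ n, P n ∧ ∀ m < n, ¬ P m := by
  by_contra! hc
  obtain ⟨n, hn⟩ := h
  have key : ∀ k, ∀ m < k, ¬ P m := by
    refine bounded_induction (S := S) (fun k => ∀ m < k, ¬ P m) ?_ ?_
    · exact fun m hm => absurd hm (hS.out.zero_le m).not_gt
    · intro k hk m hm hPm
      obtain ⟨l, hl, hPl⟩ := hc m hPm
      exact hk l (hl.trans_le (hS.out.lt_add_one_iff.1 hm)) hPl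
  exact key (n + 1) n (lt_add_one n) hn

theorem strong_induction (P : M → Prop) [hP : IsBounded S fun v => P (v 0)]
    (h : ∀ n, (∀ m < n, P m) → P n) (n : M) : P n := by
  by_contra hn
  obtain ⟨k, hk, hmin⟩ := exists_least (S := S) (fun n => ¬ P n) ⟨n, hn⟩
  exact hk (h k fun m hm => not_not.1 (hmin m hm))

theorem exists_greatest (P : M → Prop) [hP : IsBounded S fun v => P (v 0)] (n a : M) (han : a < n)
    (ha : P a) : ∃ b, (b < n ∧ P b) ∧ ∀ c < n, P c → c ≤ b := by
  by_contra! hc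
  have : ∀ j, ∃ c < n, P c ∧ j ≤ c := by
    refine bounded_induction (S := S) (fun j => ∃ c < n, P c ∧ j ≤ c)
      ⟨a, han, ha, hS.out.zero_le a⟩ ?_
    rintro j ⟨c, hcn, hPc, hjc⟩
    obtain ⟨d, hd, hPd, hcd⟩ := hc c ⟨hcn, hPc⟩
    exact ⟨d, hd, hPd, (hS.out.discrete _ _).1 (hjc.trans_lt hcd)⟩
  obtain ⟨c, hcn, -, hnc⟩ := this n
  exact hcn.not_ge hnc

/-- A `Σ⁰₁` set that is unbounded has an unbounded subset in `S`. -/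
theorem exists_unbounded_subset (θ : M → M → Prop) [IsBoundedRel S θ]
    (hu : Unbounded {a | ∃ s, θ a s}) : ∃ Z ∈ S, Unbounded Z ∧ ∀ a ∈ Z, ∃ s, θ a s := by
  let D (a s : M) : Prop := a < s ∧ ∃ t < s, θ a t
  have hD : IsBoundedRel S D :=
    ⟨inferInstanceAs (IsBounded S fun v => v 0 < v 1 ∧ ∃ t < v 1, θ (v 0) t)⟩
  have D_mono {a s s' : M} (h : D a s) (hs : s ≤ s') : D a s' :=
    ⟨h.1.trans_le hs, h.2.imp fun t ht => ⟨ht.1.trans_le hs, ht.2⟩⟩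
  let Top (a s : M) : Prop := D a s ∧ ∀ b < s, a < b → ¬ D b s
  have hTop : IsBoundedRel S Top :=
    ⟨inferInstanceAs (IsBounded S fun v => D (v 0) (v 1) ∧ ∀ b < v 1, v 0 < b → ¬ D b (v 1))⟩
  have exists_D (n : M) : ∃ s, ∃ a < s, n < a ∧ D a s := by
    obtain ⟨a, ⟨t, ht⟩, hna⟩ := hu n
    have ha : a < max a t + 1 := (le_max_left a t).trans_lt (lt_add_one _)
    exact ⟨max a t + 1, a, ha, hna, ha, t, (le_max_right a t).trans_lt (lt_add_one _), ht⟩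
  -- The set consists of the elements that are, at some stage, the largest enumerated so far. Once a
  -- larger element has appeared by stage `s`, `a` can be largest only at stages before `s`; this
  -- gives the `Π⁰₁` form.
  refine ⟨{a | ∃ s, Top a s}, delta_comprehension Top
    (fun a s => (∃ b < s, a < b ∧ D b s) → ∃ s' < s, Top a s') fun a => ⟨?_, ?_⟩, ?_, ?_⟩
  · rintro ⟨s', hs'⟩ s ⟨b, hb, hab, hD⟩
    refine ⟨s', not_le.1 fun hle => ?_, hs'⟩
    exact hs'.2 b (hb.trans_le hle) hab (D_mono hD hle)
  · intro h
    obtain ⟨s, hs⟩ := exists_D a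
    obtain ⟨s', -, h'⟩ := h s hs
    exact ⟨s', h'⟩
  · intro n
    obtain ⟨s, a, has, hna, hD⟩ := exists_D n
    obtain ⟨b, ⟨hb, hDb⟩, hmax⟩ := exists_greatest (S := S) (fun b => D b s) s a has hD
    exact ⟨b, ⟨s, hDb, fun b' hb' hlt hD' => (hmax b' hb' hD').not_gt hlt⟩,
      hna.trans_le (hmax a has hD)⟩
  · rintro a ⟨s, ⟨-, t, -, ht⟩, -⟩
    exact ⟨t, ht⟩

/-! ### Consequences of the weak Rival–Sands theorem -/

/-- The symmetric irreflexive relation that agrees with `R` on the pairs `x < y`. -/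
def Joined (R : M → M → Prop) (x y : M) : Prop := (x < y ∧ R x y) ∨ (y < x ∧ R y x)

instance IsBoundedRel.joined (R : M → M → Prop) [IsBoundedRel S R] : IsBoundedRel S (Joined R) :=
  ⟨inferInstanceAs (IsBounded S fun v => (v 0 < v 1 ∧ R (v 0) (v 1)) ∨ (v 1 < v 0 ∧ R (v 1) (v 0)))⟩

/-- Frees the principle from coded edge sets: components are at most the code of a pair, so the
edges given by `R` on `X` are obtained by bounded comprehension. -/
theorem WRSg.exists_set (h : WRSg S) {X : Set M} (hX : X ∈ S) (hXu : Unbounded X)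
    (R : M → M → Prop) [IsBoundedRel S R] :
    ∃ H ∈ S, H ⊆ X ∧ Unbounded H ∧ ∀ x ∈ H,
      Unbounded {y ∈ H | Joined R x y} ∨ {y ∈ H | Joined R x y}.Subsingleton := by
  have := Fact.mk hX
  obtain ⟨H, hH, hHX, hHu, hx⟩ := h X hX _
    (comprehension (fun z => ∃ x < z + 1, ∃ y < z + 1, x ∈ X ∧ y ∈ X ∧ x < y ∧ R x y ∧ z = pair x y))
    (fun z ⟨x, _, y, _, hx, hy, hxy, _, hz⟩ => ⟨x, hx, y, hy, hxy, hz⟩) hXu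
  refine ⟨H, hH, hHX, hHu, fun x hxH => ?_⟩
  convert hx x hxH using 2 <;>
  · ext y
    have key (x y : M) : (∃ x' < pair x y + 1, ∃ y' < pair x y + 1, x' ∈ X ∧ y' ∈ X ∧ x' < y' ∧
        R x' y' ∧ pair x y = pair x' y') ↔ x ∈ X ∧ y ∈ X ∧ x < y ∧ R x y := by
      constructor
      · rintro ⟨x', -, y', -, hx, hy, hxy, hR, he⟩
        obtain ⟨rfl, rfl⟩ := hS.out.pair_inj he
        exact ⟨hx, hy, hxy, hR⟩
      · rintro ⟨hx, hy, hxy, hR⟩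
        exact ⟨x, hS.out.lt_add_one_iff.2 (hS.out.le_pair_left x y),
          y, hS.out.lt_add_one_iff.2 (hS.out.le_pair_right x y), hx, hy, hxy, hR, rfl⟩
    simp only [neighbors, Joined, Set.mem_inter_iff, Set.mem_ofPred_eq, key]
    have hxX := hHX hxH
    constructor
    · rintro ⟨hy, h⟩
      have hyX := hHX hy
      tauto
    · tauto

/-- An infinite graph whose vertices have at most one neighbor has an infinite independent set. -/
theorem exists_independent_of_subsingleton {H : Set M} (hH : H ∈ S) (hHu : Unbounded H)
    (R : M → M → Prop) [IsBoundedRel S R] (hR : ∀ x ∈ H, {y ∈ H | Joined R x y}.Subsingleton) :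
    ∃ K ∈ S, K ⊆ H ∧ Unbounded K ∧ ∀ x ∈ K, ∀ y ∈ K, x < y → ¬ R x y := by
  have := Fact.mk hH
  -- Vertices without a smaller neighbor are pairwise unjoined. If they are bounded by `n`, every
  -- vertex above `n` has a smaller neighbor, hence no larger one.
  by_cases hK : Unbounded {x | x ∈ H ∧ ∀ y < x, y ∈ H → ¬ R y x}
  · exact ⟨_, comprehension _, fun x hx => hx.1, hK, fun x hx y hy hxy => hy.2 x hxy hx.1⟩
  · unfold Unbounded at hK
    push Not at hK
    obtain ⟨n, hn⟩ := hK
    refine ⟨{x | x ∈ H ∧ n < x}, comprehension _, fun x hx => hx.1, fun m => ?_, ?_⟩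
    · obtain ⟨x, hx, hlt⟩ := hHu (max m n)
      exact ⟨x, ⟨hx, (le_max_right m n).trans_lt hlt⟩, (le_max_left m n).trans_lt hlt⟩
    · rintro x ⟨hx, hnx⟩ y ⟨hy, -⟩ hxy hRxy
      have hx' : ¬ ∀ z < x, z ∈ H → ¬ R z x := fun h => (hn x ⟨hx, h⟩).not_gt hnx
      push Not at hx'
      obtain ⟨z, hzx, hz, hRz⟩ := hx'
      have := hR x hx ⟨hy, Or.inl ⟨hxy, hRxy⟩⟩ ⟨hz, Or.inr ⟨hzx, hRz⟩⟩
      exact (hzx.trans hxy).ne' this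

/-- Local finiteness rules out the infinite alternative, leaving at most one neighbor per vertex. -/
theorem WRSg.exists_independent (h : WRSg S) {X : Set M} (hX : X ∈ S) (hXu : Unbounded X)
    (R : M → M → Prop) [IsBoundedRel S R] (hR : ∀ x ∈ X, ∃ n, ∀ y ∈ X, n < y → ¬ R x y) :
    ∃ K ∈ S, K ⊆ X ∧ Unbounded K ∧ ∀ x ∈ K, ∀ y ∈ K, x < y → ¬ R x y := by
  obtain ⟨H, hH, hHX, hHu, hx⟩ := h.exists_set hX hXu R
  obtain ⟨K, hK, hKH, hKu⟩ := exists_independent_of_subsingleton hH hHu R fun x hxH => by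
    refine (hx x hxH).resolve_left fun hu => ?_
    obtain ⟨n, hn⟩ := hR x (hHX hxH)
    obtain ⟨y, ⟨hy, ⟨-, hxy⟩ | ⟨hyx, -⟩⟩, hlt⟩ := hu (max n x)
    · exact hn y (hHX hy) ((le_max_left n x).trans_lt hlt) hxy
    · exact hyx.not_gt ((le_max_right n x).trans_lt hlt)
  exact ⟨K, hK, hKH.trans hHX, hKu⟩

/-- A stable coloring has an infinite homogeneous set. -/
theorem WRSg.exists_homogeneous_of_stable (h : WRSg S) {X : Set M} (hX : X ∈ S)
    (hXu : Unbounded X) (R : M → M → Prop) [IsBoundedRel S R]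
    (hR : ∀ x ∈ X, ∃ n, (∀ y ∈ X, n < y → R x y) ∨ ∀ y ∈ X, n < y → ¬ R x y) :
    ∃ K ∈ S, Unbounded K ∧
      ((∀ x ∈ K, ∀ y ∈ K, x < y → R x y) ∨ ∀ x ∈ K, ∀ y ∈ K, x < y → ¬ R x y) := by
  obtain ⟨H, hH, hHX, hHu, hx⟩ := h.exists_set hX hXu R
  have := Fact.mk hH
  -- Two distinct neighbors in `H` below `s`: a `Σ⁰₁` criterion for having infinitely many, and so,
  -- by stability, for having limit color `R`.
  let θ (a s : M) : Prop :=
    a ∈ H ∧ ∃ y < s, ∃ z < s, y ∈ H ∧ z ∈ H ∧ y ≠ z ∧ Joined R a y ∧ Joined R a z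
  have hθ : IsBoundedRel S θ := ⟨inferInstanceAs (IsBounded S fun v => v 0 ∈ H ∧
    ∃ y < v 1, ∃ z < v 1, y ∈ H ∧ z ∈ H ∧ y ≠ z ∧ Joined R (v 0) y ∧ Joined R (v 0) z)⟩
  by_cases hA : Unbounded {a | ∃ s, θ a s}
  · obtain ⟨Z, hZ, hZu, hZA⟩ := exists_unbounded_subset (S := S) θ hA
    have hZH : Z ⊆ H := fun a ha => (hZA a ha).elim fun _ hs => hs.1
    have hR' : IsBoundedRel S fun x y => ¬ R x y :=
      ⟨inferInstanceAs (IsBounded S fun v => ¬ R (v 0) (v 1))⟩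
    -- On `Z` all limit colors are `R`, so the complementary graph is locally finite.
    obtain ⟨K, hK, -, hKu, hKR⟩ := h.exists_independent hZ hZu (fun x y => ¬ R x y) fun a ha => by
      obtain ⟨s, haH, y, -, z, -, hy, hz, hyz, hay, haz⟩ := hZA a ha
      have hu := (hx a haH).resolve_right fun hs => hyz (hs ⟨hy, hay⟩ ⟨hz, haz⟩)
      obtain ⟨n, hn | hn⟩ := hR a (hHX haH)
      · exact ⟨n, fun y hy hny => not_not.2 (hn y (hHX (hZH hy)) hny)⟩
      · obtain ⟨y, ⟨hy, ⟨-, hxy⟩ | ⟨hyx, -⟩⟩, hlt⟩ := hu (max n a)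
        · exact absurd hxy (hn y (hHX hy) ((le_max_left n a).trans_lt hlt))
        · exact absurd hyx ((le_max_right n a).trans_lt hlt).not_gt
    exact ⟨K, hK, hKu, Or.inl fun x hx y hy hxy => not_not.1 (hKR x hx y hy hxy)⟩
  · unfold Unbounded at hA
    push Not at hA
    obtain ⟨n, hn⟩ := hA
    obtain ⟨K, hK, -, hKu, hKR⟩ := exists_independent_of_subsingleton (S := S)
      (H := {x | x ∈ H ∧ n < x}) (comprehension _) (fun m => by
        obtain ⟨x, hx, hlt⟩ := hHu (max m n)
        exact ⟨x, ⟨hx, (le_max_right m n).trans_lt hlt⟩, (le_max_left m n).trans_lt hlt⟩) R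
      fun x hxH y hy z hz => by
        by_contra hyz
        refine (hn x ⟨max y z + 1, hxH.1, y, ?_, z, ?_, hy.1.1, hz.1.1, hyz, hy.2, hz.2⟩).not_gt hxH.2
        · exact (le_max_left y z).trans_lt (lt_add_one _)
        · exact (le_max_right y z).trans_lt (lt_add_one _)
    exact ⟨K, hK, hKu, Or.inr hKR⟩

end

end

section

variable {M : Type u} [CommSemiring M] [LinearOrder M] [IsStrictOrderedRing M] {S : Set (Set M)}

/-! ### Powers of two -/

section

theorem IsModelRCA0.lt_two_iff (hS : IsModelRCA0 S) {x : M} : x < 2 ↔ x = 0 ∨ x = 1 := by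
  rw [← one_add_one_eq_two, hS.lt_add_one_iff, le_iff_lt_or_eq, hS.lt_one_iff]

theorem IsModelRCA0.two_le (hS : IsModelRCA0 S) {x : M} (h0 : x ≠ 0) (h1 : x ≠ 1) : 2 ≤ x :=
  not_lt.1 fun h => (hS.lt_two_iff.1 h).elim h0 h1

theorem IsModelRCA0.two_mul_ne (hS : IsModelRCA0 S) (a b : M) : 2 * a ≠ 2 * b + 1 := by
  intro h
  rcases le_or_gt a b with hab | hab
  · exact h.not_lt ((mul_le_mul_of_nonneg_left hab zero_le_two).trans_lt (lt_add_one _))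
  · have h1 : 2 * (b + 1) ≤ 2 * a := mul_le_mul_of_nonneg_left ((hS.discrete _ _).1 hab) zero_le_two
    refine h.not_gt (lt_of_lt_of_le ?_ h1)
    rw [mul_add, mul_one, ← one_add_one_eq_two, ← add_assoc]
    exact lt_add_one _

theorem exists_eq_add_one_of_ne_zero (S : Set (Set M)) [hS : Fact (IsModelRCA0 S)] {n : M}
    (hn : n ≠ 0) : ∃ k, n = k + 1 := by
  have := bounded_induction (S := S) (fun n : M => n = 0 ∨ ∃ k < n, n = k + 1) (Or.inl rfl)
    (fun n _ => Or.inr ⟨n, lt_add_one n, rfl⟩) n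
  exact (this.resolve_left hn).imp fun _ h => h.2

theorem exists_eq_two_mul_or (S : Set (Set M)) [hS : Fact (IsModelRCA0 S)] (n : M) :
    ∃ k < n + 1, n = 2 * k ∨ n = 2 * k + 1 := by
  refine bounded_induction (S := S) (fun n : M => ∃ k < n + 1, n = 2 * k ∨ n = 2 * k + 1)
    ⟨0, by simp, by simp⟩ ?_ n
  rintro n ⟨k, hk, rfl | rfl⟩
  · exact ⟨k, hk.trans (lt_add_one _), Or.inr rfl⟩
  · exact ⟨k + 1, by simpa using hk, Or.inl (by ring)⟩

/-- The powers of two: the positive numbers all of whose divisors other than `1` are even. -/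
def powersOfTwo (M : Type u) [CommSemiring M] [LinearOrder M] : Set M :=
  {p | 0 < p ∧ ∀ d < p + 1, (∃ e < p + 1, p = d * e) → d = 1 ∨ ∃ k < d + 1, d = 2 * k}

theorem IsModelRCA0.le_of_mul (hS : IsModelRCA0 S) {p d e : M} (hp : 0 < p) (h : p = d * e) :
    d ≤ p := by
  have he : e ≠ 0 := by rintro rfl; simp [h] at hp
  rw [h]
  exact le_mul_of_one_le_right (hS.zero_le d) (hS.one_le he)

theorem IsModelRCA0.mem_powersOfTwo_iff (hS : IsModelRCA0 S) {p : M} :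
    p ∈ powersOfTwo M ↔ 0 < p ∧ ∀ d, d ∣ p → d = 1 ∨ 2 ∣ d := by
  refine and_congr_right fun hp => ⟨fun h d ⟨e, he⟩ => ?_, fun h d _ ⟨e, _, he⟩ => ?_⟩
  · have hd : d < p + 1 := hS.lt_add_one_iff.2 (hS.le_of_mul hp he)
    have he' : e < p + 1 := hS.lt_add_one_iff.2 (hS.le_of_mul hp (he.trans (mul_comm d e)))
    exact (h d hd ⟨e, he', he⟩).imp_right fun ⟨k, _, hk⟩ => ⟨k, hk⟩
  · refine (h d ⟨e, he⟩).imp_right fun ⟨k, hk⟩ => ⟨k, hS.lt_add_one_iff.2 ?_, hk⟩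
    rw [hk]
    exact le_mul_of_one_le_left (hS.zero_le k) one_le_two

variable [hS : Fact (IsModelRCA0 S)]

instance : Fact (powersOfTwo M ∈ S) :=
  ⟨comprehension (fun p : M =>
    0 < p ∧ ∀ d < p + 1, (∃ e < p + 1, p = d * e) → d = 1 ∨ ∃ k < d + 1, d = 2 * k)⟩

theorem one_mem_powersOfTwo (S : Set (Set M)) [hS : Fact (IsModelRCA0 S)] :
    (1 : M) ∈ powersOfTwo M := by
  refine hS.out.mem_powersOfTwo_iff.2 ⟨one_pos, fun d ⟨e, he⟩ => Or.inl ?_⟩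
  refine le_antisymm (hS.out.le_of_mul one_pos he) (hS.out.one_le ?_)
  rintro rfl
  simp at he

theorem two_mul_mem_powersOfTwo (S : Set (Set M)) [hS : Fact (IsModelRCA0 S)] {p : M}
    (hp : p ∈ powersOfTwo M) : 2 * p ∈ powersOfTwo M := by
  rw [hS.out.mem_powersOfTwo_iff] at hp ⊢
  refine ⟨mul_pos two_pos hp.1, fun d ⟨e, he⟩ => ?_⟩
  obtain ⟨k, -, hk | hk⟩ := exists_eq_two_mul_or S d
  · exact Or.inr ⟨k, hk⟩
  obtain ⟨l, -, hl | hl⟩ := exists_eq_two_mul_or S e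
  · refine hp.2 d ⟨l, (mul_left_cancel_iff_of_pos two_pos).1 ?_⟩
    rw [he, hl]
    ring
  · refine absurd he ?_
    rw [hk, hl, show (2 * k + 1) * (2 * l + 1) = 2 * (2 * k * l + k + l) + 1 by ring]
    exact hS.out.two_mul_ne _ _

theorem exists_half_mem_powersOfTwo (S : Set (Set M)) [hS : Fact (IsModelRCA0 S)] {p : M}
    (hp : p ∈ powersOfTwo M) (h1 : p ≠ 1) :
    ∃ q ∈ powersOfTwo M, p = 2 * q := by
  rw [hS.out.mem_powersOfTwo_iff] at hp
  obtain ⟨q, hq⟩ := (hp.2 p dvd_rfl).resolve_left h1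
  refine ⟨q, hS.out.mem_powersOfTwo_iff.2 ⟨?_, fun d hd => ?_⟩, hq⟩
  · exact pos_of_mul_pos_right (hq ▸ hp.1) zero_le_two
  · exact hp.2 d (hq ▸ hd.mul_left 2)

theorem unbounded_powersOfTwo (S : Set (Set M)) [hS : Fact (IsModelRCA0 S)] :
    Unbounded (powersOfTwo M) := by
  intro n
  -- The bound `2 * n + 2` keeps the induction formula bounded; it leaves room for one doubling,
  -- needed exactly when `p = n + 1`.
  have := bounded_induction (S := S) (fun n : M => ∃ p < 2 * n + 2, p ∈ powersOfTwo M ∧ n < p)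
    ⟨1, by simp, one_mem_powersOfTwo S, one_pos⟩ ?_ n
  · obtain ⟨p, -, hp, hnp⟩ := this
    exact ⟨p, hp, hnp⟩
  · rintro n ⟨p, hp2, hp, hnp⟩
    rcases (hS.out.discrete _ _ |>.1 hnp).lt_or_eq with h | h
    · exact ⟨p, hp2.trans (by gcongr; exact lt_add_one n), hp, h⟩
    · refine ⟨2 * p, ?_, two_mul_mem_powersOfTwo S hp, ?_⟩
      · rw [← h]
        exact lt_add_of_pos_right _ two_pos
      · rw [h]
        exact lt_mul_of_one_lt_left ((hS.out.zero_le n).trans_lt hnp) one_lt_two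

theorem dvd_of_mem_powersOfTwo (S : Set (Set M)) [hS : Fact (IsModelRCA0 S)] {p q : M}
    (hp : p ∈ powersOfTwo M) (hq : q ∈ powersOfTwo M) (hpq : p ≤ q) : p ∣ q := by
  have key := strong_induction (S := S) (fun p : M => ∀ r < q + 1, p ∈ powersOfTwo M →
    r ∈ powersOfTwo M → p ≤ r → ∃ e < r + 1, r = p * e) ?_ p q (lt_add_one q) hp hq hpq
  · obtain ⟨e, -, he⟩ := key
    exact ⟨e, he⟩
  · intro p ih r hrq hp hr hpr
    rcases eq_or_ne p 1 with rfl | h1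
    · exact ⟨r, lt_add_one r, (one_mul r).symm⟩
    have hp0 : 0 < p := hp.1
    have hr1 : r ≠ 1 := by
      rintro rfl
      exact h1 (hpr.antisymm (hS.out.one_le hp0.ne'))
    obtain ⟨p', hp', rfl⟩ := exists_half_mem_powersOfTwo S hp h1
    obtain ⟨r', hr', rfl⟩ := exists_half_mem_powersOfTwo S hr hr1
    have hrr : r' ≤ 2 * r' := le_mul_of_one_le_left (hS.out.zero_le r') one_le_two
    obtain ⟨e, he, hre⟩ := ih p' (lt_mul_of_one_lt_left hp'.1 one_lt_two) r' (hrr.trans_lt hrq) hp'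
      hr' (le_of_mul_le_mul_left hpr two_pos)
    refine ⟨e, he.trans_le (by gcongr), ?_⟩
    conv_lhs => rw [hre]
    ring

theorem two_mul_dvd_of_mem_powersOfTwo (S : Set (Set M)) [hS : Fact (IsModelRCA0 S)] {p q : M}
    (hp : p ∈ powersOfTwo M) (hq : q ∈ powersOfTwo M) (hpq : p < q) : 2 * p ∣ q := by
  refine dvd_of_mem_powersOfTwo S (two_mul_mem_powersOfTwo S hp) hq ?_
  obtain ⟨e, rfl⟩ := dvd_of_mem_powersOfTwo S hp hq hpq.le
  rw [mul_comm]
  refine mul_le_mul_of_nonneg_left (hS.out.two_le ?_ ?_) hp.1.le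
  · rintro rfl
    exact hq.1.ne' (mul_zero p)
  · rintro rfl
    exact hpq.ne (mul_one p).symm

/-! ### Coding a sequence of bits by a dyadic rational -/

/-- The binary digits of the rational `w / n` at the powers of two below `n` are given by `C`. -/
def HasDigits (C : M → Prop) (n w : M) : Prop :=
  ∀ p < n, p ∈ powersOfTwo M → ∃ a < 2 * p * w + 1, a * n ≤ 2 * p * w ∧ 2 * p * w < (a + 1) * n ∧
    ((∃ k < a + 1, a = 2 * k + 1) ↔ C p)

/-- Passing from `w / n` to `(2w + e) / (2n)` appends the digit `e` at position `n`. For `p < n` the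
number `2p` divides `n`, so adding less than `1 / n` does not change the integral part of `2p * w /
n`. -/
theorem HasDigits.double (S : Set (Set M)) [hS : Fact (IsModelRCA0 S)] {C : M → Prop}
    {n w e : M} (hn : n ∈ powersOfTwo M) (h : HasDigits C n w) (he : e = 0 ∧ ¬ C n ∨ e = 1 ∧ C n) :
    HasDigits C (2 * n) (2 * w + e) := by
  intro p hp hpP
  have he1 : e ≤ 1 := by
    rcases he with ⟨rfl, -⟩ | ⟨rfl, -⟩
    · exact zero_le_one
    · exact le_rfl
  have he0 : 0 ≤ e := hS.out.zero_le e
  have hpn : p ≤ n := by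
    obtain ⟨d, hd⟩ := two_mul_dvd_of_mem_powersOfTwo S hpP (two_mul_mem_powersOfTwo S hn) hp
    refine hS.out.le_of_mul hn.1 (e := d) ((mul_left_cancel_iff_of_pos two_pos).1 ?_)
    rw [hd, mul_assoc]
  rcases hpn.lt_or_eq with hlt | rfl
  · obtain ⟨a, ha, h1, h2, h3⟩ := h p hlt hpP
    obtain ⟨d, rfl⟩ := two_mul_dvd_of_mem_powersOfTwo S hpP hn hlt
    have hp2 : 0 < 2 * p := mul_pos two_pos hpP.1
    have h1' : a * d ≤ w := by
      refine le_of_mul_le_mul_left (a := 2 * p) ?_ hp2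
      rwa [mul_left_comm]
    have h2' : w + 1 ≤ (a + 1) * d := by
      refine (hS.out.discrete _ _).1 (lt_of_mul_lt_mul_left (a := 2 * p) ?_ hp2.le)
      rwa [mul_left_comm _ _ d]
    have h3' : w ≤ 2 * w + e :=
      (le_mul_of_one_le_left (hS.out.zero_le w) one_le_two).trans (le_add_of_nonneg_right he0)
    refine ⟨a, ha.trans_le (by gcongr), ?_, ?_, h3⟩
    · calc a * (2 * (2 * p * d)) = 2 * p * (2 * (a * d)) := by ring
        _ ≤ 2 * p * (2 * w) := by gcongr
        _ ≤ 2 * p * (2 * w + e) := by gcongr; exact le_add_of_nonneg_right he0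
    · calc 2 * p * (2 * w + e) < 2 * p * (2 * w + 2) := by
            gcongr
            exact he1.trans_lt one_lt_two
        _ = 2 * p * (2 * (w + 1)) := by ring
        _ ≤ 2 * p * (2 * ((a + 1) * d)) := by gcongr
        _ = (a + 1) * (2 * (2 * p * d)) := by ring
  · have hp2 : 0 < 2 * p := mul_pos two_pos hpP.1
    refine ⟨2 * w + e, hS.out.lt_add_one_iff.2 ?_, (mul_comm _ _).le, ?_, ?_⟩
    · exact le_mul_of_one_le_left (hS.out.zero_le _) (hS.out.one_le hp2.ne')
    · rw [mul_comm _ (2 * p)]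
      exact mul_lt_mul_of_pos_left (lt_add_one _) hp2
    · rcases he with ⟨rfl, hC⟩ | ⟨rfl, hC⟩
      · refine iff_of_false (fun ⟨k, _, hk⟩ => hS.out.two_mul_ne w k ?_) hC
        rwa [add_zero] at hk
      · refine iff_of_true ⟨w, ?_, rfl⟩ hC
        refine hS.out.lt_add_one_iff.2 ?_
        exact (le_mul_of_one_le_left (hS.out.zero_le w) one_le_two).trans
          (le_add_of_nonneg_right zero_le_one)

instance IsBoundedRel.hasDigits (X : Set M) [Fact (X ∈ S)] :
    IsBoundedRel S (HasDigits (· ∈ X)) :=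
  ⟨inferInstanceAs (IsBounded S fun v => ∀ p < v 0, p ∈ powersOfTwo M → ∃ a < 2 * p * v 1 + 1,
    a * v 0 ≤ 2 * p * v 1 ∧ 2 * p * v 1 < (a + 1) * v 0 ∧ ((∃ k < a + 1, a = 2 * k + 1) ↔ p ∈ X))⟩

theorem exists_hasDigits {X : Set M} (hX : X ∈ S) {n : M} (hn : n ∈ powersOfTwo M) :
    ∃ w < n, HasDigits (· ∈ X) n w := by
  have := Fact.mk hX
  refine strong_induction (S := S) (fun n => n ∈ powersOfTwo M → ∃ w < n, HasDigits (· ∈ X) n w)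
    (fun n ih hn => ?_) n hn
  rcases eq_or_ne n 1 with rfl | h1
  · exact ⟨0, one_pos, fun p hp hpP => absurd (hS.out.lt_one_iff.1 hp) hpP.1.ne'⟩
  · obtain ⟨q, hq, rfl⟩ := exists_half_mem_powersOfTwo S hn h1
    obtain ⟨w, hw, hd⟩ := ih q (lt_mul_of_one_lt_left hq.1 one_lt_two) hq
    have hlt {e : M} (he : e ≤ 1) : 2 * w + e < 2 * q :=
      calc 2 * w + e ≤ 2 * w + 1 := by gcongr
        _ < 2 * w + 2 := by gcongr; exact one_lt_two
        _ = 2 * (w + 1) := by ring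
        _ ≤ 2 * q := by gcongr; exact (hS.out.discrete _ _).1 hw
    by_cases hC : q ∈ X
    · exact ⟨2 * w + 1, hlt le_rfl, HasDigits.double S hq hd (Or.inr ⟨rfl, hC⟩)⟩
    · exact ⟨2 * w + 0, hlt zero_le_one, HasDigits.double S hq hd (Or.inl ⟨rfl, hC⟩)⟩

/-- A definable choice, for every power of two `x`, of a rational `V x / x` whose binary digits are
the colors of the pairs `p < x`. -/
theorem exists_digit_function (C : M → M → Prop) [IsBoundedRel S C] :
    ∃ V : M → M, (∀ x, V x ≤ x) ∧ IsBoundedRel S (fun x w => w = V x) ∧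
      ∀ x ∈ powersOfTwo M, HasDigits (fun p => C p x) x (V x) := by
  let Q (x w : M) : Prop := w < x + 1 ∧ (x ∈ powersOfTwo M → HasDigits (fun p => C p x) x w)
  have hQ : IsBoundedRel S Q := ⟨inferInstanceAs (IsBounded S fun v => v 1 < v 0 + 1 ∧
    (v 0 ∈ powersOfTwo M → ∀ p < v 0, p ∈ powersOfTwo M → ∃ a < 2 * p * v 1 + 1,
      a * v 0 ≤ 2 * p * v 1 ∧ 2 * p * v 1 < (a + 1) * v 0 ∧
        ((∃ k < a + 1, a = 2 * k + 1) ↔ C p (v 0))))⟩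
  have exists_Q (x : M) : ∃ w, Q x w := by
    by_cases hx : x ∈ powersOfTwo M
    · obtain ⟨w, hw, hd⟩ := exists_hasDigits (S := S) (comprehension (fun p => C p x)) hx
      exact ⟨w, hw.trans (lt_add_one x), fun _ => hd⟩
    · exact ⟨0, (hS.out.zero_le x).trans_lt (lt_add_one x), fun h => absurd h hx⟩
  -- Taking the least value makes the graph of `V` bounded-definable.
  choose V hV hmin using fun x => exists_least (S := S) (fun w => Q x w) (exists_Q x)
  refine ⟨V, fun x => hS.out.lt_add_one_iff.1 (hV x).1, ⟨?_⟩, fun x hx => (hV x).2 hx⟩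
  refine IsBounded.congr (P := fun v => Q (v 0) (v 1) ∧ ∀ w < v 1, ¬ Q (v 0) w) inferInstance
    fun v => ⟨fun h => ?_, fun h => ?_⟩
  · refine le_antisymm (not_lt.1 fun hlt => h.2 _ hlt (hV _)) (not_lt.1 fun hlt => ?_)
    exact hmin _ _ hlt h.1
  · rw [h]
    exact ⟨hV _, hmin _⟩

end

end

section

variable {M : Type u} [CommSemiring M] [LinearOrder M] {S : Set (Set M)}

theorem WRSgr.wRSg (h : WRSgr S) : WRSg S := by
  intro V hV E hE hG hVu
  obtain ⟨H, hH, hHV, hHu, hx⟩ := h V hV E hE hG hVu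
  refine ⟨H, hH, hHV, hHu, fun x hxH => (hx x hxH).imp_right fun he => ?_⟩
  rw [he]
  exact Set.subsingleton_empty

/-! ### Convergent subsequences of a sequence of rationals -/

/-- `V x / x ≤ V y / y`. -/
def RatioLE (V : M → M) (x y : M) : Prop := V x * y ≤ V y * x

theorem RatioLE.total (V : M → M) (x y : M) : RatioLE V x y ∨ RatioLE V y x := le_total _ _

section

variable [IsStrictOrderedRing M] {V : M → M}

theorem IsModelRCA0.ratioLE_trans (hS : IsModelRCA0 S) {x y z : M} (hy : 0 < y)
    (h1 : RatioLE V x y) (h2 : RatioLE V y z) : RatioLE V x z := by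
  refine le_of_mul_le_mul_left (a := y) ?_ hy
  have hx := hS.zero_le x
  have hz := hS.zero_le z
  unfold RatioLE at h1 h2
  calc y * (V x * z) = V x * y * z := by ring
    _ ≤ V y * x * z := by gcongr
    _ = V y * z * x := by ring
    _ ≤ V z * y * x := by gcongr
    _ = y * (V z * x) := by ring

theorem IsModelRCA0.le_of_ratioLE (hS : IsModelRCA0 S) {x y j k : M} (hx : 0 < x)
    (h : RatioLE V x y) (hk : k * x ≤ j * V x) : k * y ≤ j * V y := by
  refine le_of_mul_le_mul_left (a := x) ?_ hx
  have hy := hS.zero_le y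
  have hj := hS.zero_le j
  unfold RatioLE at h
  calc x * (k * y) = k * x * y := by ring
    _ ≤ j * V x * y := by gcongr
    _ = j * (V x * y) := by ring
    _ ≤ j * (V y * x) := by gcongr
    _ = x * (j * V y) := by ring

variable [hS : Fact (IsModelRCA0 S)]

/-- `V` is not a term; since `V x ≤ x`, its values can be introduced through its graph by bounded
quantifiers. -/
theorem isBoundedRel_ratioLE (hV : ∀ x, V x ≤ x) [IsBoundedRel S fun x w => w = V x] :
    IsBoundedRel S (RatioLE V) := by
  let G (x w : M) : Prop := w = V x
  have hG : IsBoundedRel S G := ‹_›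
  refine ⟨IsBounded.congr (P := fun v => ∃ a < v 0 + 1, ∃ b < v 1 + 1, G (v 0) a ∧ G (v 1) b ∧
    a * v 1 ≤ b * v 0) inferInstance fun v => ⟨?_, fun h => ?_⟩⟩
  · rintro ⟨_, -, _, -, rfl, rfl, h⟩
    exact h
  · exact ⟨_, hS.out.lt_add_one_iff.2 (hV _), _, hS.out.lt_add_one_iff.2 (hV _), rfl, rfl, h⟩

theorem isBoundedRel_mul_le (hV : ∀ x, V x ≤ x) [IsBoundedRel S fun x w => w = V x] (j : M) :
    IsBoundedRel S fun k x => k * x ≤ j * V x := by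
  let G (x w : M) : Prop := w = V x
  have hG : IsBoundedRel S G := ‹_›
  refine ⟨IsBounded.congr (P := fun v => ∃ a < v 1 + 1, G (v 1) a ∧ v 0 * v 1 ≤ j * a)
    inferInstance fun v => ⟨?_, fun h => ?_⟩⟩
  · rintro ⟨_, -, rfl, h⟩
    exact h
  · exact ⟨_, hS.out.lt_add_one_iff.2 (hV _), rfl, h⟩

/-- A `Σ⁰₁` predicate that holds at `0` and fails at `n` holds at some `k` and fails at `k + 1`. -/
theorem exists_sigma_last (P : M → M → Prop) [IsBoundedRel S P] {n : M} (h0 : ∃ m, P 0 m)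
    (hn : ¬ ∃ m, P n m) : ∃ k, (∃ m, P k m) ∧ ¬ ∃ m, P (k + 1) m := by
  by_contra! hc
  exact hn (sigma_induction (S := S) P h0 hc n)

/-- A `Σ⁰₁` predicate that fails at `0` and holds at `n` fails at some `k` and holds at `k + 1`. -/
theorem exists_sigma_first (P : M → M → Prop) [IsBoundedRel S P] {n : M} (h0 : ¬ ∃ m, P 0 m)
    (hn : ∃ m, P n m) : ∃ k, (¬ ∃ m, P k m) ∧ ∃ m, P (k + 1) m := by
  -- Reflecting `k` to `n - k` exchanges first and last.
  let Q (j m : M) : Prop := ∃ k < n + 1, k + j = n ∧ P k m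
  have hQ : IsBoundedRel S Q :=
    ⟨inferInstanceAs (IsBounded S fun v => ∃ k < n + 1, k + v 0 = n ∧ P k (v 1))⟩
  obtain ⟨j, ⟨m, k, hk, hkj, hP⟩, hj⟩ := exists_sigma_last (S := S) Q (n := n)
    (hn.imp fun m hm => ⟨n, lt_add_one n, add_zero n, hm⟩) (by
      rintro ⟨m, k, -, hk, hP⟩
      have : k = 0 := add_right_cancel (b := n) (by rw [hk, zero_add])
      exact h0 ⟨m, this ▸ hP⟩)
  have hk0 : k ≠ 0 := by
    rintro rfl
    exact h0 ⟨m, hP⟩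
  obtain ⟨l, rfl⟩ := exists_eq_add_one_of_ne_zero S hk0
  refine ⟨l, fun ⟨m', hm'⟩ => hj ⟨m', l, (lt_add_one l).trans hk, ?_, hm'⟩, m, hP⟩
  rw [← hkj]
  ring

theorem exists_ratio_max {H : Set M} (hH : H ∈ S) (hpos : ∀ x ∈ H, 0 < x)
    [IsBoundedRel S (RatioLE V)] {x : M} (hx : x ∈ H) :
    ∃ m ∈ H, ∀ y ∈ H, y ≤ x → RatioLE V y m := by
  have := Fact.mk hH
  have key := bounded_induction (S := S) (fun n => ∀ x < n, x ∈ H →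
    ∃ m < n, m ∈ H ∧ ∀ y < n, y ∈ H → RatioLE V y m)
    (fun x hx _ => absurd hx (hS.out.zero_le x).not_gt) ?_ (x + 1) x (lt_add_one x) hx
  · obtain ⟨m, -, hm, h⟩ := key
    exact ⟨m, hm, fun y hy hyx => h y (hS.out.lt_add_one_iff.2 hyx) hy⟩
  · intro n ih x hxn hx
    by_cases hlt : ∃ z < n, z ∈ H
    · obtain ⟨z, hzn, hz⟩ := hlt
      obtain ⟨m, hmn, hm, hmax⟩ := ih z hzn hz
      by_cases hn : n ∈ H ∧ RatioLE V m n
      · refine ⟨n, lt_add_one n, hn.1, fun y hy hyH => ?_⟩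
        rcases (hS.out.lt_add_one_iff.1 hy).lt_or_eq with h | rfl
        · exact hS.out.ratioLE_trans (hpos m hm) (hmax y h hyH) hn.2
        · exact le_rfl
      · refine ⟨m, hmn.trans (lt_add_one n), hm, fun y hy hyH => ?_⟩
        rcases (hS.out.lt_add_one_iff.1 hy).lt_or_eq with h | rfl
        · exact hmax y h hyH
        · exact (RatioLE.total V y m).resolve_right fun h => hn ⟨hyH, h⟩
    · refine ⟨x, hxn, hx, fun y hy hyH => ?_⟩
      have hle {y : M} (hyH : y ∈ H) : n ≤ y := not_lt.1 fun h => hlt ⟨y, h, hyH⟩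
      have hxy : x = y := ((hS.out.lt_add_one_iff.1 hxn).trans (hle hyH)).antisymm
        ((hS.out.lt_add_one_iff.1 hy).trans (hle hx))
      exact hxy ▸ le_rfl

/-- The sequence `V x / x`, `x ∈ X`, converges, in the sense that for each `j` the integral part of
`j * V x / x` is eventually constant. -/
def Converges (V : M → M) (X : Set M) : Prop :=
  ∀ j, ∃ k n, ∀ x ∈ X, n < x → k * x ≤ j * V x ∧ j * V x < (k + 1) * x

/-- A sequence each of whose terms eventually exceeds all later ones converges. -/
theorem converges_of_eventually_lt {B : Set M} (hB : B ∈ S) (hBu : Unbounded B)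
    (hpos : ∀ x ∈ B, 0 < x) (hV : ∀ x, V x ≤ x) [IsBoundedRel S fun x w => w = V x]
    (h : ∀ b ∈ B, ∃ n, ∀ x ∈ B, n < x → ¬ RatioLE V b x) : Converges V B := by
  intro j
  have := Fact.mk hB
  let T (k x : M) : Prop := k * x ≤ j * V x
  have hT : IsBoundedRel S T := isBoundedRel_mul_le hV j
  let P (k x : M) : Prop := x ∈ B ∧ ¬ T k x
  have hP : IsBoundedRel S P := ⟨inferInstanceAs (IsBounded S fun v => v 1 ∈ B ∧ ¬ T (v 0) (v 1))⟩
  obtain ⟨b₀, hb₀, -⟩ := hBu 0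
  -- No term has `j * q_x < k`, while `b` has `j * q_b < k + 1`; later terms eventually lie below
  -- `q_b`. The search ends by `j + 1` because ratios are at most `1`.
  obtain ⟨k, hk, b, hb, hbk⟩ := exists_sigma_first (S := S) P (n := j + 1)
    (by
      rintro ⟨x, -, hx⟩
      refine hx ?_
      change 0 * x ≤ j * V x
      rw [zero_mul]
      exact hS.out.zero_le _)
    ⟨b₀, hb₀, not_le.2 (by
      calc j * V b₀ ≤ j * b₀ := mul_le_mul_of_nonneg_left (hV b₀) (hS.out.zero_le j)
        _ < (j + 1) * b₀ := mul_lt_mul_of_pos_right (lt_add_one j) (hpos b₀ hb₀))⟩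
  obtain ⟨n, hn⟩ := h b hb
  refine ⟨k, n, fun x hx hnx => ⟨not_lt.1 fun hlt => hk ⟨x, hx, not_le.2 hlt⟩, not_le.1 fun hle => ?_⟩⟩
  refine hbk (hS.out.le_of_ratioLE (hpos x hx) ?_ hle)
  exact (RatioLE.total V b x).resolve_left (hn x hx hnx)

/-- If `A`, given by the `Σ⁰₁` formula `∃ s, θ`, consists of elements of `H` which are infinitely
often exceeded, and the other elements of `H` eventually exceed everything, then there is a
convergent subsequence. -/
theorem exists_converges {H : Set M} (hH : H ∈ S) (hHu : Unbounded H)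
    (hpos : ∀ x ∈ H, 0 < x) (hV : ∀ x, V x ≤ x) [IsBoundedRel S fun x w => w = V x]
    (θ : M → M → Prop) [IsBoundedRel S θ] (hθH : ∀ a s, θ a s → a ∈ H)
    (hA : ∀ a s, θ a s → ∀ n, ∃ y ∈ H, n < y ∧ RatioLE V a y)
    (hB : ∀ b ∈ H, (¬ ∃ s, θ b s) → ∃ n, ∀ x ∈ H, n < x → ¬ RatioLE V b x)
    (hAB : (∀ a ∈ H, ∃ s, θ a s) ∨ Unbounded {b ∈ H | ¬ ∃ s, θ b s}) :
    ∃ X ∈ S, X ⊆ H ∧ Unbounded X ∧ Converges V X := by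
  have := Fact.mk hH
  have hle : IsBoundedRel S (RatioLE V) := isBoundedRel_ratioLE hV
  by_cases hBS : {b ∈ H | ¬ ∃ s, θ b s} ∈ S ∧ Unbounded {b ∈ H | ¬ ∃ s, θ b s}
  · refine ⟨_, hBS.1, fun x hx => hx.1, hBS.2, converges_of_eventually_lt hBS.1 hBS.2
      (fun x hx => hpos x hx.1) hV fun b hb => ?_⟩
    obtain ⟨n, hn⟩ := hB b hb.1 hb.2
    exact ⟨n, fun x hx => hn x hx.1⟩
  have hlt {a s b : M} (ha : θ a s) (hb : b ∈ H) (hb' : ¬ ∃ s, θ b s) : ¬ RatioLE V b a := by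
    intro hba
    obtain ⟨n, hn⟩ := hB b hb hb'
    obtain ⟨y, hy, hny, hay⟩ := hA a s ha n
    exact hn y hy hny (hS.out.ratioLE_trans (hpos a (hθH a s ha)) hba hay)
  -- Keep the `x` that dominate every member of `A` recognized before `x`. By `hlt`, all elements of
  -- `H` outside `A` qualify.
  refine ⟨{x | x ∈ H ∧ ∀ a < x, ∀ s < x, θ a s → RatioLE V a x}, comprehension _, fun x hx => hx.1,
    fun n => ?_, fun j => ?_⟩
  · rcases hAB with hall | hBu
    · obtain ⟨x, hx, hnx⟩ := hHu n
      -- When `H` is all of `A`, the first `y` past `x` whose ratio is at least the maximum up to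
      -- `x` dominates everything before it.
      obtain ⟨m, hm, hmax⟩ := exists_ratio_max hH hpos hx (V := V)
      obtain ⟨s, hs⟩ := hall m hm
      obtain ⟨y, ⟨hy, hxy, hmy⟩, hmin⟩ := exists_least (S := S)
        (fun y => y ∈ H ∧ x < y ∧ RatioLE V m y) (hA m s hs x)
      refine ⟨y, ⟨hy, fun a ha t _ hat => ?_⟩, hnx.trans hxy⟩
      refine hS.out.ratioLE_trans (hpos m hm) ?_ hmy
      rcases le_or_gt a x with hax | hax
      · exact hmax a (hθH a t hat) hax
      · exact (RatioLE.total V a m).resolve_right fun h => hmin a ha ⟨hθH a t hat, hax, h⟩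
    · obtain ⟨b, hb, hnb⟩ := hBu n
      exact ⟨b, ⟨hb.1, fun a _ s _ ha => (RatioLE.total V a b).resolve_right (hlt ha hb.1 hb.2)⟩, hnb⟩
  · let T (k x : M) : Prop := k * x ≤ j * V x
    have hT : IsBoundedRel S T := isBoundedRel_mul_le hV j
    let P (k m : M) : Prop := ∃ a < m, ∃ s < m, θ a s ∧ T k a
    have hP : IsBoundedRel S P :=
      ⟨inferInstanceAs (IsBounded S fun v => ∃ a < v 1, ∃ s < v 1, θ a s ∧ T (v 0) a)⟩
    have hPiff (k : M) : (∃ m, P k m) ↔ ∃ a s, θ a s ∧ T k a := by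
      constructor
      · rintro ⟨m, a, -, s, -, h⟩
        exact ⟨a, s, h⟩
      · rintro ⟨a, s, h⟩
        exact ⟨max a s + 1, a, (le_max_left a s).trans_lt (lt_add_one _), s,
          (le_max_right a s).trans_lt (lt_add_one _), h⟩
    have hne : ∃ a s, θ a s := by
      by_contra! hc
      have : {b ∈ H | ¬ ∃ s, θ b s} = H := Set.ext fun b => by simp [hc]
      exact hBS (by rw [this]; exact ⟨hH, hHu⟩)
    -- `k` is a value reached by `j * q_a` for some `a` in `A`, while no member of `A` reaches `k +
    -- 1`. Elements of the new set past this `a` and its witness stay at or above `k`.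
    obtain ⟨k, hk, hk1⟩ := exists_sigma_last (S := S) P (n := j + 1)
      (by
        obtain ⟨a, s, h⟩ := hne
        refine (hPiff 0).2 ⟨a, s, h, ?_⟩
        change 0 * a ≤ j * V a
        rw [zero_mul]
        exact hS.out.zero_le _)
      (by
        rw [hPiff]
        rintro ⟨a, s, h, hle⟩
        refine hle.not_gt ?_
        calc j * V a ≤ j * a := mul_le_mul_of_nonneg_left (hV a) (hS.out.zero_le j)
          _ < (j + 1) * a := mul_lt_mul_of_pos_right (lt_add_one j) (hpos a (hθH a s h)))
    rw [hPiff] at hk hk1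
    obtain ⟨a, s, has, hka⟩ := hk
    have hlow : ∀ x ∈ {x | x ∈ H ∧ ∀ a < x, ∀ s < x, θ a s → RatioLE V a x}, max a s < x →
        k * x ≤ j * V x := fun x hx hlt =>
      hS.out.le_of_ratioLE (hpos a (hθH a s has)) (hx.2 a ((le_max_left a s).trans_lt hlt) s
        ((le_max_right a s).trans_lt hlt) has) hka
    by_cases hb : ∃ b ∈ H, (¬ ∃ s, θ b s) ∧ ¬ T (k + 1) b
    · obtain ⟨b, hb, hb', hbk⟩ := hb
      obtain ⟨n, hn⟩ := hB b hb hb'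
      refine ⟨k, max n (max a s), fun x hx hlt => ⟨hlow x hx ((le_max_right _ _).trans_lt hlt),
        not_le.1 fun hle => ?_⟩⟩
      refine hbk (hS.out.le_of_ratioLE (hpos x hx.1) ?_ hle)
      exact (RatioLE.total V b x).resolve_left (hn x hx.1 ((le_max_left _ _).trans_lt hlt))
    · push Not at hb
      -- Now `k + 1` separates `A` from its complement in `H`, which is therefore in `S`. As the
      -- first case failed, that complement is not unbounded, so `H` is all of `A` and no term
      -- reaches `k + 1`.
      have hBeq : {b ∈ H | ¬ ∃ s, θ b s} = {b | b ∈ H ∧ T (k + 1) b} := by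
        ext b
        refine and_congr_right fun hbH => ⟨fun h => ?_, fun h ⟨s, hs⟩ => hk1 ⟨b, s, hs, h⟩⟩
        exact hb b hbH (not_exists.1 h)
      have hBS' : {b ∈ H | ¬ ∃ s, θ b s} ∈ S := by
        rw [hBeq]
        exact comprehension _
      have hall := hAB.resolve_right fun h => hBS ⟨hBS', h⟩
      refine ⟨k, max a s, fun x hx hlt => ⟨hlow x hx hlt, not_le.1 fun hle => ?_⟩⟩
      obtain ⟨t, ht⟩ := hall x hx.1
      exact hk1 ⟨x, t, ht, hle⟩

theorem WRSg.exists_converges (h : WRSg S) {X : Set M} (hX : X ∈ S) (hXu : Unbounded X)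
    (hpos : ∀ x ∈ X, 0 < x) (hV : ∀ x, V x ≤ x) [IsBoundedRel S fun x w => w = V x] :
    ∃ Y ∈ S, Y ⊆ X ∧ Unbounded Y ∧ Converges V Y := by
  have hle : IsBoundedRel S (RatioLE V) := isBoundedRel_ratioLE hV
  obtain ⟨H, hH, hHX, hHu, hx⟩ := h.exists_set hX hXu (RatioLE V)
  have := Fact.mk hH
  let θ (a s : M) : Prop := a ∈ H ∧ ∃ y < s, ∃ z < s, y ∈ H ∧ z ∈ H ∧ y ≠ z ∧
    Joined (RatioLE V) a y ∧ Joined (RatioLE V) a z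
  have hθ : IsBoundedRel S θ := ⟨inferInstanceAs (IsBounded S fun v => v 0 ∈ H ∧
    ∃ y < v 1, ∃ z < v 1, y ∈ H ∧ z ∈ H ∧ y ≠ z ∧
      Joined (RatioLE V) (v 0) y ∧ Joined (RatioLE V) (v 0) z)⟩
  have hA (a s : M) (has : θ a s) (n : M) : ∃ y ∈ H, n < y ∧ RatioLE V a y := by
    obtain ⟨ha, y, -, z, -, hy, hz, hyz, hay, haz⟩ := has
    have hu := (hx a ha).resolve_right fun hs => hyz (hs ⟨hy, hay⟩ ⟨hz, haz⟩)
    obtain ⟨y, ⟨hy, ⟨-, hay⟩ | ⟨hya, -⟩⟩, hlt⟩ := hu (max n a)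
    · exact ⟨y, hy, (le_max_left n a).trans_lt hlt, hay⟩
    · exact absurd hya ((le_max_right n a).trans_lt hlt).not_gt
  by_cases hBu : Unbounded {b ∈ H | ¬ ∃ s, θ b s}
  · obtain ⟨Y, hY, hYH, hYu⟩ := SecondOrderArithmetic.exists_converges hH hHu
      (fun x hx => hpos x (hHX hx)) hV θ (fun a s h => h.1) hA (fun b hb hb' => by
        by_contra! hc
        obtain ⟨y, hy, hby, hRy⟩ := hc b
        obtain ⟨z, hz, hyz, hRz⟩ := hc y
        exact hb' ⟨z + 1, hb, y, hyz.trans (lt_add_one z), z, lt_add_one z, hy, hz, hyz.ne,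
          Or.inl ⟨hby, hRy⟩, Or.inl ⟨hby.trans hyz, hRz⟩⟩) (Or.inr hBu)
    exact ⟨Y, hY, hYH.trans hHX, hYu⟩
  · unfold Unbounded at hBu
    push Not at hBu
    obtain ⟨n, hn⟩ := hBu
    have hall {a : M} (ha : a ∈ H) (hna : n < a) : ∃ s, θ a s := by
      by_contra hc
      exact (hn a ⟨ha, not_exists.1 hc⟩).not_gt hna
    -- Past `n` every vertex lies in `A`, so membership needs no witness.
    have hθ' : IsBoundedRel S fun a _ => a ∈ H ∧ n < a :=
      ⟨inferInstanceAs (IsBounded S fun v => v 0 ∈ H ∧ n < v 0)⟩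
    obtain ⟨Y, hY, hYH, hYu⟩ := SecondOrderArithmetic.exists_converges (S := S) (V := V)
      (H := {x | x ∈ H ∧ n < x}) (comprehension _) (fun m => by
        obtain ⟨x, hx, hlt⟩ := hHu (max m n)
        exact ⟨x, ⟨hx, (le_max_right m n).trans_lt hlt⟩, (le_max_left m n).trans_lt hlt⟩)
      (fun x hx => hpos x (hHX hx.1)) hV (fun a _ => a ∈ H ∧ n < a) (fun a s h => h)
      (fun a s ha m => by
        obtain ⟨t, ht⟩ := hall ha.1 ha.2
        obtain ⟨y, hy, hlt, hay⟩ := hA a t ht (max m n)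
        exact ⟨y, ⟨hy, (le_max_right m n).trans_lt hlt⟩, (le_max_left m n).trans_lt hlt, hay⟩)
      (fun b hb hb' => absurd ⟨b, hb⟩ hb') (Or.inl fun a ha => ⟨a, ha⟩)
    exact ⟨Y, hY, fun x hx => hHX (hYH hx).1, hYu⟩

/-! ### The equivalence -/

theorem WRSg.rt22 (h : WRSg S) : RT22 S := by
  intro c hc hcol
  have := Fact.mk hc
  let C (x y : M) : Prop := pair (pair x y) 1 ∈ c
  have hC : IsBoundedRel S C :=
    ⟨inferInstanceAs (IsBounded S fun v => pair (pair (v 0) (v 1)) 1 ∈ c)⟩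
  obtain ⟨V, hV, hVS, hd⟩ := exists_digit_function (S := S) C
  obtain ⟨X, hX, hXP, hXu, hconv⟩ := h.exists_converges (Fact.out : powersOfTwo M ∈ S)
    (unbounded_powersOfTwo S) (fun x hx => hx.1) hV
  obtain ⟨K, hK, hKu, hhom⟩ := h.exists_homogeneous_of_stable hX hXu C fun x hx => by
    -- The color of `(x, y)` is the parity of the integral part of `2x * q_y`, which is eventually
    -- `k`.
    obtain ⟨k, n, hkn⟩ := hconv (2 * x)
    have key : ∀ y ∈ X, max n x < y → ((∃ l < k + 1, k = 2 * l + 1) ↔ C x y) := by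
      intro y hy hlt
      obtain ⟨hk1, hk2⟩ := hkn y hy ((le_max_left n x).trans_lt hlt)
      obtain ⟨a, -, ha1, ha2, ha⟩ := hd y (hXP hy) x ((le_max_right n x).trans_lt hlt) (hXP hx)
      have hy0 : 0 ≤ y := hS.out.zero_le y
      have hak : a = k := le_antisymm
        (hS.out.lt_add_one_iff.1 (lt_of_mul_lt_mul_right (ha1.trans_lt hk2) hy0))
        (hS.out.lt_add_one_iff.1 (lt_of_mul_lt_mul_right (hk1.trans_lt ha2) hy0))
      rwa [hak] at ha
    by_cases hodd : ∃ l < k + 1, k = 2 * l + 1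
    · exact ⟨max n x, Or.inl fun y hy hlt => (key y hy hlt).1 hodd⟩
    · exact ⟨max n x, Or.inr fun y hy hlt hc => hodd ((key y hy hlt).2 hc)⟩
  refine ⟨K, hK, hKu, ?_⟩
  rcases hhom with hhom | hhom
  · exact ⟨1, Or.inr rfl, hhom⟩
  · refine ⟨0, Or.inl rfl, fun x hx y hy hxy => ?_⟩
    obtain ⟨i, hi, -⟩ := hcol.2 x y hxy
    obtain ⟨x', y', i', -, hi', he⟩ := hcol.1 _ hi
    obtain ⟨-, rfl⟩ := hS.out.pair_inj he
    rcases hi' with rfl | rfl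
    · exact hi
    · exact absurd hi (hhom x hx y hy hxy)

/-- Ramsey's theorem for a coloring given by a bounded formula. -/
theorem RT22.exists_homogeneous (h : RT22 S) (R : M → M → Prop) [IsBoundedRel S R] :
    ∃ H ∈ S, Unbounded H ∧
      ((∀ x ∈ H, ∀ y ∈ H, x < y → R x y) ∨ ∀ x ∈ H, ∀ y ∈ H, x < y → ¬ R x y) := by
  let c : Set M := {z | ∃ t < z + 1, ∃ i < z + 1, z = pair t i ∧ ∃ x < t + 1, ∃ y < t + 1,
    t = pair x y ∧ x < y ∧ (i = 0 ∧ ¬ R x y ∨ i = 1 ∧ R x y)}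
  have hc : c ∈ S := comprehension _
  have key (x y i : M) : pair (pair x y) i ∈ c ↔ x < y ∧ (i = 0 ∧ ¬ R x y ∨ i = 1 ∧ R x y) := by
    constructor
    · rintro ⟨t, -, i', -, he, x', -, y', -, rfl, h⟩
      obtain ⟨he', rfl⟩ := hS.out.pair_inj he
      obtain ⟨rfl, rfl⟩ := hS.out.pair_inj he'
      exact h
    · intro h
      exact ⟨_, hS.out.lt_add_one_iff.2 (hS.out.le_pair_left _ _), _,
        hS.out.lt_add_one_iff.2 (hS.out.le_pair_right _ _), rfl, _,
        hS.out.lt_add_one_iff.2 (hS.out.le_pair_left _ _), _,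
        hS.out.lt_add_one_iff.2 (hS.out.le_pair_right _ _), rfl, h⟩
  have hcol : IsColoring c := by
    refine ⟨?_, fun x y hxy => ?_⟩
    · rintro z ⟨t, -, i, -, rfl, x, -, y, -, rfl, hxy, h⟩
      exact ⟨x, y, i, hxy, h.imp (fun h => h.1) (fun h => h.1), rfl⟩
    · simp only [key]
      by_cases hR : R x y <;> simp [hR, hxy]
  obtain ⟨H, hH, hHu, i, hi, hhom⟩ := h c hc hcol
  refine ⟨H, hH, hHu, ?_⟩
  simp only [key] at hhom
  rcases hi with rfl | rfl
  · right
    intro x hx y hy hxy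
    rcases (hhom x hx y hy hxy).2 with h | h
    · exact h.2
    · exact absurd h.1 zero_ne_one
  · left
    intro x hx y hy hxy
    rcases (hhom x hx y hy hxy).2 with h | h
    · exact absurd h.1 one_ne_zero
    · exact h.2

theorem RT22.wRSgr (h : RT22 S) : WRSgr S := by
  intro V hV E hE hG hVu
  have := Fact.mk hV
  have := Fact.mk hE
  -- `a` is the largest vertex up to `x`. This monotone partial map pulls the graph back to all
  -- numbers without enumerating `V`.
  let L (x a : M) : Prop := a < x + 1 ∧ a ∈ V ∧ ∀ b < x + 1, b ∈ V → b ≤ a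
  have hL : IsBoundedRel S L :=
    ⟨inferInstanceAs (IsBounded S fun v => v 1 < v 0 + 1 ∧ v 1 ∈ V ∧ ∀ b < v 0 + 1, b ∈ V → b ≤ v 1)⟩
  have L_mono {x y a b : M} (hxy : x ≤ y) (ha : L x a) (hb : L y b) : a ≤ b :=
    hb.2.2 a (ha.1.trans_le (by gcongr)) ha.2.1
  have L_unique {x a b : M} (ha : L x a) (hb : L x b) : a = b :=
    (L_mono le_rfl ha hb).antisymm (L_mono le_rfl hb ha)
  let R (x y : M) : Prop := ∃ a < x + 1, ∃ b < y + 1, L x a ∧ L y b ∧ pair a b ∈ E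
  have hR : IsBoundedRel S R := ⟨inferInstanceAs (IsBounded S fun v =>
    ∃ a < v 0 + 1, ∃ b < v 1 + 1, L (v 0) a ∧ L (v 1) b ∧ pair a b ∈ E)⟩
  have R_iff {x y a b : M} (ha : L x a) (hb : L y b) : R x y ↔ pair a b ∈ E := by
    constructor
    · rintro ⟨a', -, b', -, ha', hb', h⟩
      rwa [L_unique ha ha', L_unique hb hb']
    · exact fun h => ⟨a, ha.1, b, hb.1, ha, hb, h⟩
  obtain ⟨H, hH, hHu, hhom⟩ := h.exists_homogeneous R
  have := Fact.mk hH
  have hθ : IsBoundedRel S fun a x => x ∈ H ∧ L x a :=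
    ⟨inferInstanceAs (IsBounded S fun v => v 1 ∈ H ∧ L (v 1) (v 0))⟩
  -- The image of `H` in `V` is only `Σ⁰₁`, so an unbounded subset in `S` is taken.
  obtain ⟨Z, hZ, hZu, hZH⟩ := exists_unbounded_subset (S := S) (fun a x => x ∈ H ∧ L x a) (by
    intro n
    obtain ⟨b, hb, hnb⟩ := hVu n
    obtain ⟨x, hx, hbx⟩ := hHu b
    obtain ⟨a, ⟨hax, ha⟩, hmax⟩ := exists_greatest (S := S) (· ∈ V) (x + 1) b
      (hbx.trans (lt_add_one x)) hb
    exact ⟨a, ⟨x, hx, hax, ha, hmax⟩, hnb.trans_le (hmax b (hbx.trans (lt_add_one x)) hb)⟩)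
  have hZV : Z ⊆ V := fun a ha => (hZH a ha).elim fun x hx => hx.2.2.1
  have edge {a b : M} (ha : a ∈ Z) (hb : b ∈ Z) (hab : a < b) :
      ∃ x ∈ H, ∃ y ∈ H, x < y ∧ (R x y ↔ pair a b ∈ E) := by
    obtain ⟨x, hx, hxa⟩ := hZH a ha
    obtain ⟨y, hy, hyb⟩ := hZH b hb
    exact ⟨x, hx, y, hy, not_le.1 fun h => (L_mono h hyb hxa).not_gt hab, R_iff hxa hyb⟩
  refine ⟨Z, hZ, hZV, hZu, fun a ha => ?_⟩
  rcases hhom with hhom | hhom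
  · left
    intro n
    obtain ⟨b, hb, hlt⟩ := hZu (max n a)
    have hab : a < b := (le_max_right n a).trans_lt hlt
    obtain ⟨x, hx, y, hy, hxy, hiff⟩ := edge ha hb hab
    exact ⟨b, ⟨hb, hZV hb, Or.inl ⟨hab, hiff.1 (hhom x hx y hy hxy)⟩⟩,
      (le_max_left n a).trans_lt hlt⟩
  · right
    refine Set.eq_empty_iff_forall_notMem.2 ?_
    rintro b ⟨hb, -, ⟨hab, hE⟩ | ⟨hba, hE⟩⟩
    · obtain ⟨x, hx, y, hy, hxy, hiff⟩ := edge ha hb hab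
      exact hhom x hx y hy hxy (hiff.2 hE)
    · obtain ⟨x, hx, y, hy, hxy, hiff⟩ := edge hb ha hba
      exact hhom x hx y hy hxy (hiff.2 hE)

end

end

end SecondOrderArithmetic

theorem mainTheorem2 {M : Type*} [CommSemiring M] [LinearOrder M] [IsStrictOrderedRing M]
    (S : Set (Set M)) (hS : SecondOrderArithmetic.IsModelRCA0 S) :
    List.TFAE [SecondOrderArithmetic.RT22 S, SecondOrderArithmetic.WRSg S,
      SecondOrderArithmetic.WRSgr S] := by
  have := Fact.mk hS
  tfae_have 1 → 3 := SecondOrderArithmetic.RT22.wRSgr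
  tfae_have 3 → 2 := SecondOrderArithmetic.WRSgr.wRSg
  tfae_have 2 → 1 := SecondOrderArithmetic.WRSg.rt22
  tfae_finish
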